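/- **Stability of the closed-loop DC microgrid.** *Model.* Consider $N$ nodes and $M$ power lines forming a connected electrical graph with incidence matrix $B\in\mathbb R^{N\times M}$ (arbitrary orientation), and a connected undirected communication graph on the nodes with weights $a_{ij}=a_{ji}\ge 0$ and Laplacian $\mathcal L_c$, $(\mathcal L_c x)_i=\sum_j a_{ij}(x_i-x_j)$. Let $R_l,L_l>0$ be the line resistances and inductances, and for each node $i$ let $R_{ti},L_{ti},C_{ti}>0$ be the filter parameters, $I^s_{ti}>0$ the rated current, $V_{ref,i}>0$ the reference voltage, $Y_{Li}>0$ and $\bar I_{Li},P^*_{Li},r_i\in\mathbb R$ the load parameters, with $P^*_{Li}\ge 0$ whenever $r_i>1$. The load current is $I_{Li}(V_i)=Y_{Li}V_i+\bar I_{Li}+V_i^{r_i-1}P^*_{Li}$. For gains $k_{1,i},\dots,k_{4,i}\in\mathbb R$ the state $X=(V,I_t,v,I,\Omega)\in\mathbb R^{4N+M}$ obeys the closed-loop dynamics $$\begin{aligned} C_{ti}\dot V_i&=I_{ti}-I_{Li}(V_i)-(BI)_i,\\ L_{ti}\dot I_{ti}&=(k_{1,i}-1)V_i+(k_{2,i}-R_{ti})I_{ti}+k_{3,i}v_i+k_{4,i}\omega_i,\\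 \dot v_i&=V_{ref,i}-V_i-\omega_i,\\ L_l\dot I_l&=(B^TV)_l-R_lI_l,\\ \dot\Omega&=\mathcal L_c[I^s_t]^{-1}I_t,\qquad \omega=[I^s_t]^{-1}\mathcal L_c\Omega, \end{aligned}\tag{1}$$ where $[x]$ is the diagonal matrix with diagonal $x$. The primary-controlled system (2), in the state $X'=(V,I_t,v,I)\in\mathbb R^{3N+M}$, consists of the first four equations with $\omega=0$. Along (1) the sum $\sum_i\Omega_i$ is constant, and adding a common constant to all $\Omega_i$ maps equilibria to equilibria. *Assumptions.* For every $i$: $k_{1,i}<1$, $k_{2,i}<R_{ti}$, $0<k_{3,i}<\frac1{L_{ti}}(k_{1,i}-1)(k_{2,i}-R_{ti})$ and $k_{4,i}=k_{1,i}-1$. *Claims.* 1. Let $\bar V\in\mathbb R^N_{>0}$ satisfy the power-flow equations $$BR^{-1}B^T\bar V+\mathcal L_t[I^s_t]^{-1}\big(I_{Li}(\bar V_i)\big)_{i}=0,\qquad \sum_iI^s_{ti}\bar V_i=\sum_iI^s_{ti}V_{ref,i},$$ where $R$ is the diagonal matrix of the line resistances and $\mathcal L_t=[I^s_t]-(\sum_iI^s_{ti})^{-1}I^s_t(I^s_t)^T$,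 and suppose that $(1-r_i)\bar P^*_{Li}<Y_{Li}\bar V_i^2$ for every $i$ with $r_i<1$, where $\bar P^*_{Li}=P^*_{Li}\bar V_i^{r_i}$. Then (1) has an equilibrium with voltages $\bar V$, and for every such equilibrium $\bar X$: - $\bar X$ is Lyapunov stable in $\mathbb R^{4N+M}$; it is locally asymptotically stable on the invariant hyperplane $\{\sum_i\Omega_i=\sum_i\bar\Omega_i\}$; and every solution of (1) on $[0,\infty)$ that starts close enough to $\bar X$ converges to the equilibrium $\bar X+(0,0,0,0,\eta\mathbf 1_N)$, $\eta=\frac1N\sum_i(\Omega_i(0)-\bar\Omega_i)$. - If $\bar P^*_L=0$, then $\bar X$ is globally asymptotically stable on this hyperplane, and every solution of (1) on $[0,\infty)$ in $\mathbb R^{4N+M}$ converges to $\bar X+(0,0,0,0,\eta\mathbf 1_N)$ with $\eta$ as above. 2. (No communication network.) Suppose that $(1-r_i)P^*_{Li}V_{ref,i}^{r_i}<Y_{Li}V_{ref,i}^2$ for every $i$ with $r_i<1$. Then (2) has exactly one equilibrium $\bar X'$, and $\bar X'$ is locally asymptotically stable in $\mathbb R^{3N+M}$. Stability and asymptotic stability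 include that solutions from the initial states concerned exist for all $t\ge 0$. -/

import Mathlib

open scoped Topology Matrix

noncomputable section

/-! ### Stability notions for an autonomous ordinary differential equation `x' = f x`

All notions are relative to a set `S` of initial states; `S = Set.univ` gives the usual ones. -/

namespace ODEStability

variable {E : Type*} [NormedAddCommGroup E] [NormedSpace ℝ E]

/-- Every solution that starts in `S` stays in `S` as long as it exists. -/
def IsForwardInvariant (f : E → E) (S : Set E) : Prop :=
  ∀ (T : ℝ) (x : ℝ → E), 0 < T → IsIntegralCurveOn x (fun _ => f) (Set.Ico 0 T) → x 0 ∈ S →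
    ∀ t ∈ Set.Ico 0 T, x t ∈ S

/-- Lyapunov stability of `xbar` for initial states in `S`: from every such state close to `xbar`
a solution exists for all times `t ≥ 0`, and every solution, on whatever interval `[0, T)`,
stays close to `xbar`. -/
def IsStableOn (f : E → E) (S : Set E) (xbar : E) : Prop :=
  ∀ ε > 0, ∃ δ > 0, ∀ x₀ ∈ S, dist x₀ xbar < δ →
    (∃ x : ℝ → E, x 0 = x₀ ∧ IsIntegralCurveOn x (fun _ => f) (Set.Ici 0)) ∧
    ∀ (T : ℝ) (x : ℝ → E), 0 < T → x 0 = x₀ → IsIntegralCurveOn x (fun _ => f) (Set.Ico 0 T) →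
      ∀ t ∈ Set.Ico 0 T, dist (x t) xbar < ε

/-- Local asymptotic stability of `xbar` on the invariant set `S`. -/
def IsLocallyAsymptoticallyStableOn (f : E → E) (S : Set E) (xbar : E) : Prop :=
  IsForwardInvariant f S ∧ IsStableOn f S xbar ∧
    ∃ δ > 0, ∀ x : ℝ → E, IsIntegralCurveOn x (fun _ => f) (Set.Ici 0) → x 0 ∈ S →
      dist (x 0) xbar < δ → Filter.Tendsto x Filter.atTop (𝓝 xbar)

/-- Global asymptotic stability of `xbar` on the invariant set `S`. -/
def IsGloballyAsymptoticallyStableOn (f : E → E) (S : Set E) (xbar : E) : Prop :=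
  IsForwardInvariant f S ∧ IsStableOn f S xbar ∧
    (∀ x₀ ∈ S, ∃ x : ℝ → E, x 0 = x₀ ∧ IsIntegralCurveOn x (fun _ => f) (Set.Ici 0)) ∧
    ∀ x : ℝ → E, IsIntegralCurveOn x (fun _ => f) (Set.Ici 0) → x 0 ∈ S →
      Filter.Tendsto x Filter.atTop (𝓝 xbar)

end ODEStability

/-- A DC microgrid with `N` nodes (each carrying a generation unit and a load) and `M` power
lines, together with the weighted communication graph between the generation units. -/
structure Microgrid (N M : ℕ) where
  /-- source node of a line, for an arbitrary orientation -/
  src : Fin M → Fin N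
  /-- sink node of a line -/
  tgt : Fin M → Fin N
  src_ne_tgt : ∀ l, src l ≠ tgt l
  /-- the electrical graph is connected -/
  electrical_connected :
    (SimpleGraph.fromRel fun i j => ∃ l, src l = i ∧ tgt l = j).Connected
  /-- line resistances -/
  R : Fin M → ℝ
  R_pos : ∀ l, 0 < R l
  /-- line inductances -/
  L : Fin M → ℝ
  L_pos : ∀ l, 0 < L l
  /-- filter resistances -/
  Rt : Fin N → ℝ
  Rt_pos : ∀ i, 0 < Rt i
  /-- filter inductances -/
  Lt : Fin N → ℝ
  Lt_pos : ∀ i, 0 < Lt i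
  /-- filter capacitances -/
  Ct : Fin N → ℝ
  Ct_pos : ∀ i, 0 < Ct i
  /-- conductances of the Z loads -/
  YL : Fin N → ℝ
  YL_pos : ∀ i, 0 < YL i
  /-- currents of the I loads -/
  IL : Fin N → ℝ
  /-- power coefficients of the E loads -/
  PL : Fin N → ℝ
  /-- exponents of the E loads -/
  r : Fin N → ℝ
  /-- reference voltages -/
  Vref : Fin N → ℝ
  Vref_pos : ∀ i, 0 < Vref i
  /-- rated currents -/
  Is : Fin N → ℝ
  Is_pos : ∀ i, 0 < Is i
  /-- weights of the communication links -/
  a : Fin N → Fin N → ℝ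
  a_nonneg : ∀ i j, 0 ≤ a i j
  a_symm : ∀ i j, a i j = a j i
  /-- the communication graph is connected -/
  communication_connected : (SimpleGraph.fromRel fun i j => 0 < a i j).Connected

/-- Feedback gains of the primary controllers. -/
structure Gains (N : ℕ) where
  k₁ : Fin N → ℝ
  k₂ : Fin N → ℝ
  k₃ : Fin N → ℝ
  k₄ : Fin N → ℝ

/-- States `(V, It, v, I, Ω)` under primary and secondary control: node voltages, filter currents,
integrator states, line currents and consensus variables. -/
abbrev State (N M : ℕ) : Type :=
  (Fin N → ℝ) × (Fin N → ℝ) × (Fin N → ℝ) × (Fin M → ℝ) × (Fin N → ℝ)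

/-- States `(V, It, v, I)` under primary control only. -/
abbrev PrimaryState (N M : ℕ) : Type :=
  (Fin N → ℝ) × (Fin N → ℝ) × (Fin N → ℝ) × (Fin M → ℝ)

namespace Microgrid

variable {N M : ℕ} (G : Microgrid N M) (K : Gains N)

/-- Incidence matrix of the electrical graph. -/
def B : Matrix (Fin N) (Fin M) ℝ :=
  Matrix.of fun i l => if G.src l = i then 1 else if G.tgt l = i then -1 else 0

/-- Current drawn by the ZIE load at node `i` at voltage `V i`. -/
def loadCurrent (V : Fin N → ℝ) (i : Fin N) : ℝ :=
  G.YL i * V i + G.IL i + V i ^ (G.r i - 1) * G.PL i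

/-- Power absorbed by the E load at node `i` at voltage `V i`. -/
def ePower (V : Fin N → ℝ) (i : Fin N) : ℝ := G.PL i * V i ^ G.r i

/-- The Laplacian of the communication graph, as an operator. -/
def commLap (x : Fin N → ℝ) (i : Fin N) : ℝ := ∑ j, G.a i j * (x i - x j)

/-- The output `ω` of the secondary layer. -/
def omega (Ω : Fin N → ℝ) (i : Fin N) : ℝ := (G.Is i)⁻¹ * G.commLap Ω i

def alpha (i : Fin N) : ℝ := (K.k₁ i - 1) / G.Lt i
def beta (i : Fin N) : ℝ := (K.k₂ i - G.Rt i) / G.Lt i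
def gamma (i : Fin N) : ℝ := K.k₃ i / G.Lt i
def delta (i : Fin N) : ℝ := K.k₄ i / G.Lt i

/-- Right-hand side of the dynamics under primary and secondary control. -/
def closedLoop : State N M → State N M := fun (V, It, v, I, Ω) =>
  (fun i => (It i - G.loadCurrent V i - (G.B *ᵥ I) i) / G.Ct i,
   fun i => G.alpha K i * V i + G.beta K i * It i + G.gamma K i * v i
      + G.delta K i * G.omega Ω i,
   fun i => G.Vref i - V i - G.omega Ω i,
   fun l => ((G.Bᵀ *ᵥ V) l - G.R l * I l) / G.L l,
   fun i => G.commLap (fun j => It j / G.Is j) i)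

/-- Right-hand side of the dynamics under primary control only. -/
def primaryLoop : PrimaryState N M → PrimaryState N M := fun (V, It, v, I) =>
  (fun i => (It i - G.loadCurrent V i - (G.B *ᵥ I) i) / G.Ct i,
   fun i => G.alpha K i * V i + G.beta K i * It i + G.gamma K i * v i,
   fun i => G.Vref i - V i,
   fun l => ((G.Bᵀ *ᵥ V) l - G.R l * I l) / G.L l)

/-- Laplacian of the electrical network. -/
def Le : Matrix (Fin N) (Fin N) ℝ := G.B * Matrix.diagonal (fun l => (G.R l)⁻¹) * G.Bᵀ

/-- `[Is] - (1ᵀ [Is] 1)⁻¹ [Is] 1 1ᵀ [Is]`. -/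
def LtMat : Matrix (Fin N) (Fin N) ℝ :=
  Matrix.diagonal G.Is - (∑ i, G.Is i)⁻¹ • Matrix.vecMulVec G.Is G.Is

/-- `V` is a positive solution of the power-flow equations under proportional current sharing and
weighted voltage balancing. -/
structure IsPositivePowerFlowSolution (V : Fin N → ℝ) : Prop where
  pos : ∀ i, 0 < V i
  flow : G.Le *ᵥ V + (G.LtMat * Matrix.diagonal (fun i => (G.Is i)⁻¹)) *ᵥ G.loadCurrent V = 0
  balance : ∑ i, G.Is i * V i = ∑ i, G.Is i * G.Vref i

/-- Restriction on the E loads with exponent less than one, at the node voltages `V`. -/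
def LoadCondition (V : Fin N → ℝ) : Prop :=
  ∀ i, G.r i < 1 → (1 - G.r i) * G.ePower V i < G.YL i * V i ^ 2

/-- The admissible gains of the primary controllers. -/
structure AdmissibleGains : Prop where
  k₁_lt : ∀ i, K.k₁ i < 1
  k₂_lt : ∀ i, K.k₂ i < G.Rt i
  k₃_pos : ∀ i, 0 < K.k₃ i
  k₃_lt : ∀ i, K.k₃ i < 1 / G.Lt i * ((K.k₁ i - 1) * (K.k₂ i - G.Rt i))

end Microgrid

namespace State

variable {N M : ℕ}

def voltage (X : State N M) : Fin N → ℝ := X.1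

def consensus (X : State N M) : Fin N → ℝ := X.2.2.2.2

/-- The states whose consensus variables have the same sum as those of `Xbar`.
This sum is a conserved quantity of the closed-loop dynamics. -/
def leaf (Xbar : State N M) : Set (State N M) :=
  {X | ∑ i, X.consensus i = ∑ i, Xbar.consensus i}

/-- `Xbar` with all its consensus variables shifted by one common constant so that their sum is
that of `X₀`: the element of the line `Xbar + ℝ (0, 0, 0, 0, 1)` in the leaf of `X₀`. -/
def shiftTo (Xbar X₀ : State N M) : State N M :=
  (Xbar.1, Xbar.2.1, Xbar.2.2.1, Xbar.2.2.2.1,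
    fun i => Xbar.consensus i + (∑ j, (X₀.consensus j - Xbar.consensus j)) / N)

end State

end

/-! A single quadratic Lyapunov function carries every stability claim. In error coordinates `(x, y,
z, w, o)` for `(V, It, v, I, Ω)` it is half of the sum of `Ct x²`, `L w²`, `o²` and, at each node,
`p y² + 2 q y z + α q z²`, with `p` the `currentWeight` and `q` the `crossWeight`. The weights
satisfy `q = 1 + p α` and `p γ = q β`. The gain conditions give `p > 0` and `q < 0`; the form in
`(y, z)` has determinant `-q`, so the energy is positive definite.

Along solutions all exchange terms cancel: capacitors against lines because `B` and `Bᵀ` are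
adjoint, `x y` because `p α - q = -1`, and `ω` against the consensus layer because the Laplacian is
symmetric and `δ = α`. What remains (`energyDeriv_sub`) is minus `dissipation`: the load terms `x
(I_L(V) - I_L(Vbar))`, a multiple of `(β y + γ z)²`, and the line losses. The load terms are
nonnegative near `Vbar`, since the load condition says that the load current has positive slope
there.

Convergence uses Barbalat's lemma repeatedly. The energy converges, so the dissipation tends to
zero; this gives `V`, `I` and `β y + γ z`. Since `V` converges, its derivative tends to zero, and
the first equation gives `It`, hence `v`. Since `It` converges, the second equation gives `ω`. As `∑
Ω` is conserved and the Laplacian is injective on zero-sum vectors, `Ω` converges to the shifted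
equilibrium.

When the E loads vanish the load is affine, the estimate holds on every ball, and sublevel sets of
the energy exhaust the space, so convergence is global. The primary system is handled by setting the
consensus error to zero. -/

noncomputable section

open Set Filter Metric

/-! ### Lyapunov's direct method and global existence of solutions -/

namespace ODEStability

variable {E : Type*} [NormedAddCommGroup E] [NormedSpace ℝ E]

/-- `W` is a differentiable function, zero at `xbar` and bounded below by a multiple of the squared
distance to `xbar`, which does not increase along `x' = f x` within distance `ρ` of `xbar`. -/
structure IsLyapunovFunctionOn (f : E → E) (W : E → ℝ) (xbar : E) (c ρ : ℝ) : Prop where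
  pos : 0 < c
  differentiable : Differentiable ℝ W
  map_eq_zero : W xbar = 0
  lower : ∀ x, c * dist x xbar ^ 2 ≤ W x
  fderiv_nonpos : ∀ x, dist x xbar ≤ ρ → fderiv ℝ W x (f x) ≤ 0

theorem hasDerivWithinAt_comp_integralCurve {f : E → E} {W : E → ℝ} (hW : Differentiable ℝ W)
    {s : Set ℝ} {x : ℝ → E} (hx : IsIntegralCurveOn x (fun _ => f) s) {t : ℝ} (ht : t ∈ s) :
    HasDerivWithinAt (fun τ => W (x τ)) (fderiv ℝ W (x t) (f (x t))) s t :=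
  (hW (x t)).hasFDerivAt.comp_hasDerivWithinAt t (hx t ht)

namespace IsLyapunovFunctionOn

variable {f : E → E} {W : E → ℝ} {xbar : E} {c ρ : ℝ}

theorem mono (h : IsLyapunovFunctionOn f W xbar c ρ) {ρ' : ℝ} (hρ : ρ' ≤ ρ) :
    IsLyapunovFunctionOn f W xbar c ρ' :=
  { h with fderiv_nonpos := fun x hx => h.fderiv_nonpos x (hx.trans hρ) }

theorem antitoneOn (h : IsLyapunovFunctionOn f W xbar c ρ) {s : Set ℝ} (hs : Convex ℝ s)
    {x : ℝ → E} (hx : IsIntegralCurveOn x (fun _ => f) s)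
    (hball : ∀ t ∈ interior s, dist (x t) xbar ≤ ρ) : AntitoneOn (fun t => W (x t)) s := by
  refine antitoneOn_of_hasDerivWithinAt_nonpos hs (f' := fun t => fderiv ℝ W (x t) (f (x t)))
    ?_ ?_ ?_
  · exact fun t ht => (hasDerivWithinAt_comp_integralCurve h.differentiable hx ht).continuousWithinAt
  · exact fun t ht => (hasDerivWithinAt_comp_integralCurve h.differentiable hx
      (interior_subset ht)).mono interior_subset
  · exact fun t ht => h.fderiv_nonpos _ (hball t ht)

/-- A solution that starts in the sublevel set `{W < c ρ²}` stays within distance `ρ`. -/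
theorem dist_lt (h : IsLyapunovFunctionOn f W xbar c ρ) (hρ : 0 < ρ) {s : Set ℝ}
    (hs : s.OrdConnected) (h0s : (0 : ℝ) ∈ s) {x : ℝ → E}
    (hx : IsIntegralCurveOn x (fun _ => f) s) (h0 : W (x 0) < c * ρ ^ 2) :
    ∀ t ∈ s, 0 ≤ t → dist (x t) xbar < ρ := by
  intro t₁ ht₁ ht₁0
  by_contra hcon
  push Not at hcon
  have hsub : Icc 0 t₁ ⊆ s := hs.out h0s ht₁
  have hcont : ContinuousOn (fun t => dist (x t) xbar) (Icc 0 t₁) :=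
    (continuous_id.dist continuous_const).comp_continuousOn (hx.continuousOn.mono hsub)
  have h00 : dist (x 0) xbar < ρ := by
    have h1 := h.lower (x 0)
    have h2 : dist (x 0) xbar ^ 2 < ρ ^ 2 := lt_of_mul_lt_mul_left (h1.trans_lt h0) h.pos.le
    exact lt_of_pow_lt_pow_left₀ 2 hρ.le h2
  -- The least element of `A` is the first time at distance at least `ρ`; up to then `W` cannot
  -- increase, yet `lower` would force `W ≥ c * ρ ^ 2` there.
  set A := Icc 0 t₁ ∩ (fun t => dist (x t) xbar) ⁻¹' Ici ρ with hA
  have hAc : IsClosed A := hcont.preimage_isClosed_of_isClosed isClosed_Icc isClosed_Ici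
  have hAk : IsCompact A := isCompact_Icc.of_isClosed_subset hAc inter_subset_left
  obtain ⟨m, hmA, hmin⟩ := hAk.exists_isLeast ⟨t₁, ⟨ht₁0, le_rfl⟩, hcon⟩
  have hm : ρ ≤ dist (x m) xbar := hmA.2
  have hsub' : Icc 0 m ⊆ s := (Icc_subset_Icc_right hmA.1.2).trans hsub
  have hanti := h.antitoneOn (convex_Icc 0 m) (hx.mono hsub') (fun t ht => by
    rw [interior_Icc] at ht
    by_contra hc
    push Not at hc
    exact absurd (hmin ⟨⟨ht.1.le, ht.2.le.trans hmA.1.2⟩, hc.le⟩) (not_le.2 ht.2))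
  have h1 : W (x m) ≤ W (x 0) := hanti ⟨le_rfl, hmA.1.1⟩ ⟨hmA.1.1, le_rfl⟩ hmA.1.1
  have h2 := h.lower (x m)
  have h3 : c * ρ ^ 2 ≤ c * dist (x m) xbar ^ 2 :=
    mul_le_mul_of_nonneg_left (pow_le_pow_left₀ hρ.le hm 2) h.pos.le
  linarith

end IsLyapunovFunctionOn

/-- A bounded Lipschitz vector field has a solution on `[0, ∞)` from every initial state. -/
theorem exists_integralCurveOn_Ici_of_lipschitzWith [CompleteSpace E] {g : E → E} {k L : NNReal}
    (hg : LipschitzWith k g) (hL : ∀ x, ‖g x‖ ≤ L) (x₀ : E) :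
    ∃ x : ℝ → E, x 0 = x₀ ∧ IsIntegralCurveOn x (fun _ => g) (Ici 0) := by
  have key : ∀ n : ℕ, ∃ x : ℝ → E, x 0 = x₀ ∧ IsIntegralCurveOn x (fun _ => g) (Icc 0 (n : ℝ)) := by
    intro n
    -- A solution of speed at most `L` travels at most `L * n` by time `n`, so this radius makes one
    -- Picard–Lindelöf step cover all of `[0, n]`.
    have hp : IsPicardLindelof (fun _ => g) (⟨0, le_rfl, n.cast_nonneg⟩ : Icc (0 : ℝ) n) x₀
        (L * n) 0 L k :=
      { lipschitzOnWith := fun _ _ => hg.lipschitzOnWith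
        continuousOn := fun _ _ => continuousOn_const
        norm_le := fun _ _ x _ => hL x
        mul_max_le := by simp }
    exact hp.exists_eq_forall_mem_Icc_hasDerivWithinAt₀
  choose y hy0 hy using key
  have huniq : ∀ m n : ℕ, m ≤ n → EqOn (y m) (y n) (Icc 0 (m : ℝ)) := by
    intro m n hmn
    have hsub : Icc (0 : ℝ) m ⊆ Icc 0 (n : ℝ) := Icc_subset_Icc_right (by exact_mod_cast hmn)
    refine ODE_solution_unique (v := fun _ => g) (K := k) (fun _ => hg)
      (hy m).continuousOn (fun t ht => ?_) ((hy n).continuousOn.mono hsub) (fun t ht => ?_)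
      (by rw [hy0, hy0])
    · exact (hy m t ⟨ht.1, ht.2.le⟩).mono_of_mem_nhdsWithin
        (mem_of_superset (Icc_mem_nhdsGE ht.2) (Icc_subset_Icc_left ht.1))
    · exact ((hy n).mono hsub t ⟨ht.1, ht.2.le⟩).mono_of_mem_nhdsWithin
        (mem_of_superset (Icc_mem_nhdsGE ht.2) (Icc_subset_Icc_left ht.1))
  -- The index `⌊t⌋₊ + 1` exceeds `t` strictly, so the glued curve agrees near `t` with a single `y
  -- n`.
  have heq : ∀ n : ℕ, EqOn (fun t => y (⌊t⌋₊ + 1) t) (y n) (Ico 0 (n : ℝ)) := by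
    intro n t ht
    have h1 : ⌊t⌋₊ + 1 ≤ n := (Nat.floor_lt ht.1).2 ht.2
    exact huniq _ _ h1 ⟨ht.1, by exact_mod_cast (Nat.lt_floor_add_one t).le⟩
  refine ⟨fun t => y (⌊t⌋₊ + 1) t, by simp [hy0], fun t ht => ?_⟩
  have ht0 : (0 : ℝ) ≤ t := ht
  obtain ⟨n, hn⟩ := exists_nat_gt t
  have h1 : HasDerivWithinAt (y n) (g (y n t)) (Ici 0) t :=
    (hy n t ⟨ht0, hn.le⟩).mono_of_mem_nhdsWithin (by
      rw [mem_nhdsWithin]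
      exact ⟨Iio n, isOpen_Iio, hn, fun s hs => ⟨hs.2, hs.1.le⟩⟩)
  have h2 : (fun t => y (⌊t⌋₊ + 1) t) =ᶠ[𝓝[Ici 0] t] y n := by
    rw [eventuallyEq_iff_exists_mem]
    refine ⟨Ico 0 (n : ℝ), ?_, heq n⟩
    rw [mem_nhdsWithin]
    exact ⟨Iio n, isOpen_Iio, hn, fun s hs => ⟨hs.2, hs.1⟩⟩
  have h3 := heq n ⟨ht0, hn⟩
  simp only at h3 ⊢
  rw [h3]
  exact h1.congr_of_eventuallyEq h2 h3

namespace IsLyapunovFunctionOn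

variable {f : E → E} {W : E → ℝ} {xbar : E} {c ρ : ℝ}

/-- Solutions from a sublevel set of a Lyapunov function exist for all times. -/
theorem exists_integralCurveOn_Ici [FiniteDimensional ℝ E]
    (h : IsLyapunovFunctionOn f W xbar c ρ)
    (hf : ∀ x, dist x xbar ≤ ρ → ContDiffAt ℝ 1 f x) {r : ℝ} (hr : 0 < r) (hrρ : r < ρ) {x₀ : E}
    (h0 : W x₀ < c * r ^ 2) :
    ∃ x : ℝ → E, x 0 = x₀ ∧ IsIntegralCurveOn x (fun _ => f) (Ici 0) := by
  -- Cutting off outside the ball yields a bounded Lipschitz field. The factor `χ ≥ 0` keeps `W`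
  -- nonincreasing, which confines the solution to radius `r`, where `χ = 1` and the field is `f`.
  let χ : ContDiffBump xbar := ⟨r, ρ, hr, hrρ⟩
  set g : E → E := fun x => χ x • f x with hgdef
  have hsupp : tsupport g ⊆ closedBall xbar ρ := by
    rw [← χ.tsupport_eq]
    exact tsupport_smul_subset_left _ _
  have hgk : HasCompactSupport g :=
    (isCompact_closedBall xbar ρ).of_isClosed_subset (isClosed_tsupport g) hsupp
  have hgc : ContDiff ℝ 1 g := contDiff_iff_contDiffAt.2 fun x => by
    by_cases hx : x ∈ tsupport g
    · exact χ.contDiff.contDiffAt.smul (hf x (hsupp hx))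
    · exact contDiffAt_const.congr_of_eventuallyEq (notMem_tsupport_iff_eventuallyEq.1 hx)
  obtain ⟨k, hk⟩ := hgc.lipschitzWith_of_hasCompactSupport hgk one_ne_zero
  obtain ⟨C, hC⟩ := hgc.continuous.bounded_above_of_compact_support hgk
  have hg : IsLyapunovFunctionOn g W xbar c r :=
    { h with
      fderiv_nonpos := fun x hx => by
        simp only [hgdef, map_smul, smul_eq_mul]
        exact mul_nonpos_of_nonneg_of_nonpos χ.nonneg (h.fderiv_nonpos x (hx.trans hrρ.le)) }
  obtain ⟨x, hx0, hx⟩ := exists_integralCurveOn_Ici_of_lipschitzWith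
    (L := ⟨max C 0, le_max_right _ _⟩) hk (fun x => (hC x).trans (le_max_left _ _)) x₀
  refine ⟨x, hx0, fun t ht => ?_⟩
  have hball := hg.dist_lt hr ordConnected_Ici self_mem_Ici hx (by rwa [hx0]) t ht ht
  have hone : χ (x t) = 1 := χ.one_of_mem_closedBall (mem_closedBall.2 hball.le)
  have := hx t ht
  simpa [hgdef, hone] using this

theorem exists_pos_forall_lt (h : IsLyapunovFunctionOn f W xbar c ρ) {r : ℝ} (hr : 0 < r) :
    ∃ δ > 0, ∀ x, dist x xbar < δ → W x < c * r ^ 2 := by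
  have hpos : 0 < c * r ^ 2 := mul_pos h.pos (pow_pos hr 2)
  have : ∀ᶠ x in 𝓝 xbar, W x < c * r ^ 2 :=
    h.differentiable.continuous.continuousAt.eventually_lt continuousAt_const
      (by rwa [h.map_eq_zero])
  exact Metric.eventually_nhds_iff.1 this

theorem isStableOn [FiniteDimensional ℝ E] (h : IsLyapunovFunctionOn f W xbar c ρ)
    (hρ : 0 < ρ) (hf : ∀ x, dist x xbar ≤ ρ → ContDiffAt ℝ 1 f x) (S : Set E) :
    IsStableOn f S xbar := by
  intro ε hε
  -- The bound `ρ / 2` leaves the gap below `ρ` that the cut-off needs.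
  have hr : 0 < min ε (ρ / 2) := lt_min hε (half_pos hρ)
  have hrρ : min ε (ρ / 2) < ρ := (min_le_right _ _).trans_lt (half_lt_self hρ)
  obtain ⟨δ, hδ, hδW⟩ := h.exists_pos_forall_lt hr
  refine ⟨δ, hδ, fun x₀ _ hx₀ => ⟨h.exists_integralCurveOn_Ici hf hr hrρ (hδW _ hx₀), ?_⟩⟩
  intro T x hT hx0 hx t ht
  exact ((h.mono hrρ.le).dist_lt hr ordConnected_Ico ⟨le_rfl, hT⟩ hx (by rw [hx0]; exact hδW _ hx₀)
    t ht ht.1).trans_le (min_le_left _ _)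

/-- `W` converges along solutions from a sublevel set. -/
theorem exists_tendsto (h : IsLyapunovFunctionOn f W xbar c ρ) {x : ℝ → E}
    (hx : IsIntegralCurveOn x (fun _ => f) (Ici 0)) (hball : ∀ t, 0 ≤ t → dist (x t) xbar ≤ ρ) :
    ∃ l, Tendsto (fun t => W (x t)) atTop (𝓝 l) := by
  have hanti := h.antitoneOn (convex_Ici 0) hx (fun t ht => hball t (interior_subset ht))
  have hanti' : Antitone fun t => W (x (max t 0)) := fun s t hst =>
    hanti (mem_Ici.2 (le_max_right _ _)) (mem_Ici.2 (le_max_right _ _)) (max_le_max_right 0 hst)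
  have hbdd : BddBelow (range fun t => W (x (max t 0))) := by
    refine ⟨0, ?_⟩
    rintro _ ⟨t, rfl⟩
    exact (mul_nonneg h.pos.le (sq_nonneg _)).trans (h.lower _)
  refine ⟨_, (tendsto_atTop_ciInf hanti' hbdd).congr' ?_⟩
  filter_upwards [eventually_ge_atTop 0] with t ht
  rw [max_eq_left ht]

end IsLyapunovFunctionOn

/-! ### Barbalat's lemma -/

/-- **Barbalat's lemma**: if `φ` converges and its derivative is uniformly continuous, then the
derivative tends to zero. -/
theorem tendsto_zero_of_uniformContinuousOn {φ u : ℝ → ℝ} {l : ℝ}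
    (hφ : ∀ t ∈ Ici (0 : ℝ), HasDerivWithinAt φ (u t) (Ici 0) t)
    (hu : UniformContinuousOn u (Ici 0)) (hl : Tendsto φ atTop (𝓝 l)) :
    Tendsto u atTop (𝓝 0) := by
  rw [Metric.tendsto_atTop]
  intro ε hε
  obtain ⟨δ, hδ, hδu⟩ := Metric.uniformContinuousOn_iff.1 hu (ε / 2) (half_pos hε)
  -- Two values of `φ` within `ε * δ / 8` of `l`, at times `δ / 2` apart, give a mean slope below `ε
  -- / 2`; uniform continuity moves this from `ξ` to `t` at the cost of another `ε / 2`.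
  have hη : 0 < ε * δ / 8 := by positivity
  obtain ⟨T, hT⟩ := Metric.tendsto_atTop.1 hl _ hη
  refine ⟨max T 0, fun t ht => ?_⟩
  have htT : T ≤ t := (le_max_left _ _).trans ht
  have ht0 : 0 ≤ t := (le_max_right _ _).trans ht
  have hlt : t < t + δ / 2 := by linarith
  have hsub : Icc t (t + δ / 2) ⊆ Ici 0 := fun s hs => ht0.trans hs.1
  obtain ⟨ξ, hξ, hξeq⟩ := exists_hasDerivAt_eq_slope φ u hlt
    (fun s hs => ((hφ s (hsub hs)).continuousWithinAt).mono hsub)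
    (fun s hs => (hφ s (hsub ⟨hs.1.le, hs.2.le⟩)).hasDerivAt
      (Ici_mem_nhds (ht0.trans_lt hs.1)))
  have h1 := hT t htT
  have h2 := hT (t + δ / 2) (by linarith)
  rw [Real.dist_eq, abs_lt] at h1 h2
  have h3 := hδu t ht0 ξ (hsub ⟨hξ.1.le, hξ.2.le⟩) (by
    rw [Real.dist_eq, abs_lt]; constructor <;> linarith [hξ.1, hξ.2])
  have h4 : u ξ * (δ / 2) = φ (t + δ / 2) - φ t := by
    rw [hξeq, add_sub_cancel_left, div_mul_cancel₀ _ (half_pos hδ).ne']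
  have h5 : |u ξ| < ε / 2 := by
    rw [abs_lt]; constructor <;> nlinarith
  rw [Real.dist_eq, sub_zero]
  rw [Real.dist_eq] at h3
  calc |u t| = |(u t - u ξ) + u ξ| := by ring_nf
    _ ≤ |u t - u ξ| + |u ξ| := abs_add_le _ _
    _ < ε := by linarith

/-- If `φ` converges along a bounded solution, then its derivative `g` along the solution tends
to zero. -/
theorem tendsto_zero_along_integralCurve [FiniteDimensional ℝ E] {f : E → E} {xbar : E} {ρ : ℝ}
    (hf : ContinuousOn f (closedBall xbar ρ)) {x : ℝ → E}
    (hx : IsIntegralCurveOn x (fun _ => f) (Ici 0)) (hball : ∀ t, 0 ≤ t → dist (x t) xbar ≤ ρ)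
    {φ : ℝ → ℝ} {g : E → ℝ} (hg : ContinuousOn g (closedBall xbar ρ))
    (hφ : ∀ t ∈ Ici (0 : ℝ), HasDerivWithinAt φ (g (x t)) (Ici 0) t) {l : ℝ}
    (hl : Tendsto φ atTop (𝓝 l)) : Tendsto (fun t => g (x t)) atTop (𝓝 0) := by
  refine tendsto_zero_of_uniformContinuousOn hφ ?_ hl
  obtain ⟨C, hC⟩ := (isCompact_closedBall xbar ρ).exists_bound_of_continuousOn hf
  have hmem : MapsTo x (Ici 0) (closedBall xbar ρ) := fun t ht => mem_closedBall.2 (hball t ht)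
  -- The field is bounded on the compact ball, so the solution is Lipschitz and `g` along it is
  -- uniformly continuous.
  have hlip : LipschitzOnWith (Real.toNNReal C) x (Ici 0) :=
    (convex_Ici 0).lipschitzOnWith_of_nnnorm_hasDerivWithin_le hx fun t ht => by
      rw [← NNReal.coe_le_coe, coe_nnnorm]
      exact (hC _ (hmem ht)).trans (Real.le_coe_toNNReal C)
  exact ((isCompact_closedBall xbar ρ).uniformContinuousOn_of_continuous hg).comp
    hlip.uniformContinuousOn hmem

end ODEStability

/-! ### Coercivity of positive definite quadratic functions -/

/-- A continuous positive definite function that is homogeneous of degree two is bounded below by a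
multiple of the squared norm. -/
theorem exists_pos_mul_norm_sq_le {E : Type*} [NormedAddCommGroup E] [NormedSpace ℝ E]
    [FiniteDimensional ℝ E] {Q : E → ℝ} (hQ : Continuous Q)
    (hsmul : ∀ (t : ℝ) x, Q (t • x) = t ^ 2 * Q x) (hpos : ∀ x, x ≠ 0 → 0 < Q x) :
    ∃ c > 0, ∀ x, c * ‖x‖ ^ 2 ≤ Q x := by
  have h0 : Q 0 = 0 := by simpa using hsmul 0 0
  rcases (sphere (0 : E) 1).eq_empty_or_nonempty with he | hne
  · refine ⟨1, one_pos, fun x => ?_⟩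
    have hx : x = 0 := by
      by_contra hx
      have : ‖x‖⁻¹ • x ∈ sphere (0 : E) 1 := by
        simp [norm_smul, inv_mul_cancel₀ (norm_ne_zero_iff.2 hx)]
      simp [he] at this
    simp [hx, h0]
  · obtain ⟨y, hy, hmin⟩ := (isCompact_sphere (0 : E) 1).exists_isMinOn hne hQ.continuousOn
    have hy0 : y ≠ 0 := by
      rintro rfl
      simp at hy
    refine ⟨Q y, hpos y hy0, fun x => ?_⟩
    by_cases hx : x = 0
    · simp [hx, h0]
    have hn := norm_ne_zero_iff.2 hx
    have hmem : ‖x‖⁻¹ • x ∈ sphere (0 : E) 1 := by simp [norm_smul, inv_mul_cancel₀ hn]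
    have h1 : Q y ≤ Q (‖x‖⁻¹ • x) := hmin hmem
    have h2 : Q x = ‖x‖ ^ 2 * Q (‖x‖⁻¹ • x) := by
      rw [← hsmul, smul_smul, mul_inv_cancel₀ hn, one_smul]
    rw [h2, mul_comm]
    exact mul_le_mul_of_nonneg_left h1 (sq_nonneg _)

namespace Microgrid

variable {N M : ℕ} (G : Microgrid N M) (K : Gains N)

/-! ### The communication Laplacian -/

/-- The communication Laplacian as a linear map. -/
def commLapLin : (Fin N → ℝ) →ₗ[ℝ] (Fin N → ℝ) where
  toFun := G.commLap
  map_add' x y := by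
    ext i
    simp only [commLap, Pi.add_apply, ← Finset.sum_add_distrib]
    exact Finset.sum_congr rfl fun j _ => by ring
  map_smul' t x := by
    ext i
    simp only [commLap, Pi.smul_apply, smul_eq_mul, RingHom.id_apply, Finset.mul_sum]
    exact Finset.sum_congr rfl fun j _ => by ring

theorem commLap_sub (x y : Fin N → ℝ) : G.commLap (x - y) = G.commLap x - G.commLap y :=
  map_sub G.commLapLin x y

theorem commLap_zero : G.commLap 0 = 0 := map_zero G.commLapLin

theorem commLap_add_const (x : Fin N → ℝ) (η : ℝ) :
    G.commLap (fun i => x i + η) = G.commLap x := by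
  ext i
  simp [commLap]

theorem omega_zero : G.omega 0 = 0 := by
  ext i
  simp [omega, commLap_zero]

/-- Exchanging the two indices, under symmetric weights, and averaging makes the form symmetric in
`x` and `y`. Self-adjointness, zero column sums and the kernel of the Laplacian all follow from it.
-/
theorem sum_mul_commLap (x y : Fin N → ℝ) :
    ∑ i, x i * G.commLap y i = (∑ i, ∑ j, G.a i j * ((x i - x j) * (y i - y j))) / 2 := by
  have h1 : ∑ i, x i * G.commLap y i = ∑ i, ∑ j, G.a i j * (x i * (y i - y j)) := by
    refine Finset.sum_congr rfl fun i _ => ?_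
    rw [commLap, Finset.mul_sum]
    exact Finset.sum_congr rfl fun j _ => by ring
  have h2 : ∑ i, ∑ j, G.a i j * (x i * (y i - y j)) = ∑ i, ∑ j, G.a i j * (x j * (y j - y i)) := by
    rw [Finset.sum_comm]
    exact Finset.sum_congr rfl fun i _ => Finset.sum_congr rfl fun j _ => by rw [G.a_symm]
  have h3 : ∑ i, ∑ j, G.a i j * ((x i - x j) * (y i - y j))
      = ∑ i, ∑ j, G.a i j * (x i * (y i - y j)) + ∑ i, ∑ j, G.a i j * (x j * (y j - y i)) := by
    simp only [← Finset.sum_add_distrib]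
    exact Finset.sum_congr rfl fun i _ => Finset.sum_congr rfl fun j _ => by ring
  rw [h3, ← h2, h1]
  ring

theorem sum_mul_commLap_comm (x y : Fin N → ℝ) :
    ∑ i, x i * G.commLap y i = ∑ i, G.commLap x i * y i := by
  rw [sum_mul_commLap]
  simp only [mul_comm (G.commLap x _), sum_mul_commLap, mul_comm (x _ - x _)]

theorem sum_commLap (x : Fin N → ℝ) : ∑ i, G.commLap x i = 0 := by
  simpa using G.sum_mul_commLap (fun _ => 1) x

/-- The quadratic form is a sum of nonnegative terms, so `x` agrees across each link of positive
weight, and then along paths. -/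
theorem eq_of_commLap_eq_zero {x : Fin N → ℝ} (hx : G.commLap x = 0) (i j : Fin N) :
    x i = x j := by
  have h1 := G.sum_mul_commLap x x
  have hnn : ∀ i j, 0 ≤ G.a i j * ((x i - x j) * (x i - x j)) := fun i j =>
    mul_nonneg (G.a_nonneg i j) (mul_self_nonneg _)
  have h2 : ∑ i, ∑ j, G.a i j * ((x i - x j) * (x i - x j)) = 0 := by
    simp only [hx, Pi.zero_apply, mul_zero, Finset.sum_const_zero] at h1
    linarith
  have h3 : ∀ i j, G.a i j * ((x i - x j) * (x i - x j)) = 0 := fun i j => by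
    have h4 := (Finset.sum_eq_zero_iff_of_nonneg fun i _ =>
      Finset.sum_nonneg fun j _ => hnn i j).1 h2 i (Finset.mem_univ i)
    exact (Finset.sum_eq_zero_iff_of_nonneg fun j _ => hnn i j).1 h4 j (Finset.mem_univ j)
  have h4 : ∀ i j, 0 < G.a i j → x i = x j := fun i j hij => by
    have := (mul_eq_zero.1 (h3 i j)).resolve_left hij.ne'
    linarith [mul_self_eq_zero.1 this]
  obtain ⟨p⟩ := G.communication_connected.preconnected i j
  induction p with
  | nil => rfl
  | cons hadj _ ih =>
    rw [← ih]
    rw [SimpleGraph.fromRel_adj] at hadj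
    exact hadj.2.elim (h4 _ _) fun h => (h4 _ _ h).symm

theorem card_pos {N M : ℕ} (G : Microgrid N M) : 0 < N := by
  obtain ⟨i⟩ := G.communication_connected.nonempty
  exact i.pos

/-- The communication Laplacian plus the all-ones matrix, which is invertible. -/
def commLapAddOnes : (Fin N → ℝ) →ₗ[ℝ] (Fin N → ℝ) where
  toFun x i := G.commLap x i + ∑ j, x j
  map_add' x y := by
    ext i
    have := congrFun (map_add G.commLapLin x y) i
    simp only [commLapLin, LinearMap.coe_mk, AddHom.coe_mk, Pi.add_apply] at this
    simp only [this, Pi.add_apply, Finset.sum_add_distrib]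
    ring
  map_smul' t x := by
    ext i
    have := congrFun (map_smul G.commLapLin t x) i
    simp only [commLapLin, LinearMap.coe_mk, AddHom.coe_mk, Pi.smul_apply, smul_eq_mul] at this
    simp only [this, Pi.smul_apply, smul_eq_mul, ← Finset.mul_sum, RingHom.id_apply]
    ring

theorem commLapAddOnes_apply (x : Fin N → ℝ) (i : Fin N) :
    G.commLapAddOnes x i = G.commLap x i + ∑ j, x j := rfl

theorem sum_commLapAddOnes (x : Fin N → ℝ) :
    ∑ i, G.commLapAddOnes x i = N * ∑ j, x j := by
  simp [commLapAddOnes_apply, Finset.sum_add_distrib, sum_commLap]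

/-- Summing coordinates removes the Laplacian and leaves `N` times the sum of `x`. A kernel element
thus has zero sum, then zero Laplacian, so it is constant and vanishes. -/
theorem commLapAddOnes_injective : Function.Injective G.commLapAddOnes := by
  rw [← LinearMap.ker_eq_bot, LinearMap.ker_eq_bot']
  intro x hx
  have hN : (N : ℝ) ≠ 0 := by exact_mod_cast G.card_pos.ne'
  have hsum : ∑ j, x j = 0 := by
    have := G.sum_commLapAddOnes x
    rw [hx] at this
    simpa [hN] using this.symm
  have hlap : G.commLap x = 0 := by
    ext i
    have := congrFun hx i
    rw [commLapAddOnes_apply, hsum, add_zero] at this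
    exact this
  ext i
  have : ∑ j, x j = N * x i := by
    rw [Finset.sum_congr rfl fun j _ => G.eq_of_commLap_eq_zero hlap j i]
    simp
  rw [hsum] at this
  simpa [hN] using this.symm

/-- Every vector with zero sum is in the range of the communication Laplacian. -/
theorem exists_commLap_eq {b : Fin N → ℝ} (hb : ∑ i, b i = 0) : ∃ x, G.commLap x = b := by
  have hN : (N : ℝ) ≠ 0 := by exact_mod_cast G.card_pos.ne'
  obtain ⟨x, hx⟩ := LinearMap.injective_iff_surjective.1 G.commLapAddOnes_injective b
  have hsum : ∑ j, x j = 0 := by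
    have := G.sum_commLapAddOnes x
    rw [hx, hb] at this
    simpa [hN] using this.symm
  refine ⟨x, ?_⟩
  ext i
  rw [← hx, commLapAddOnes_apply, hsum, add_zero]

/-- Vectors of zero sum tend to zero if their images under the communication Laplacian do. -/
theorem tendsto_zero_of_commLap {ι : Type*} {F : Filter ι} {x : ι → Fin N → ℝ}
    (hsum : ∀ᶠ t in F, ∑ i, x t i = 0) (hlap : Tendsto (fun t => G.commLap (x t)) F (𝓝 0)) :
    Tendsto x F (𝓝 0) := by
  -- On zero-sum vectors the Laplacian agrees with this invertible map, whose inverse is continuous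
  -- in finite dimension.
  let e := LinearEquiv.ofInjectiveEndo G.commLapAddOnes G.commLapAddOnes_injective
  have hcont : Continuous e.symm := LinearMap.continuous_of_finiteDimensional e.symm.toLinearMap
  have h1 := (hcont.tendsto 0).comp hlap
  rw [map_zero] at h1
  refine h1.congr' ?_
  filter_upwards [hsum] with t ht
  rw [Function.comp_apply, LinearEquiv.symm_apply_eq]
  ext i
  change G.commLap (x t) i = G.commLapAddOnes (x t) i
  rw [commLapAddOnes_apply, ht, add_zero]

/-! ### Equilibria -/

theorem sum_mul_mulVec_B (x : Fin N → ℝ) (w : Fin M → ℝ) :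
    ∑ i, x i * (G.B *ᵥ w) i = ∑ l, w l * (G.Bᵀ *ᵥ x) l := by
  have h := Matrix.dotProduct_mulVec x G.B w
  rw [← Matrix.mulVec_transpose, dotProduct_comm (G.Bᵀ *ᵥ x)] at h
  exact h

theorem Le_mulVec (V : Fin N → ℝ) :
    G.Le *ᵥ V = G.B *ᵥ fun l => (G.Bᵀ *ᵥ V) l / G.R l := by
  rw [Le, ← Matrix.mulVec_mulVec, ← Matrix.mulVec_mulVec]
  congr 1
  ext l
  rw [Matrix.mulVec_diagonal, div_eq_inv_mul]

/-- The matrix removes from `x` the share of its total that is proportional to the rated currents.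
The flow equation therefore says that each node supplies one common multiple of its rated current.
-/
theorem LtMat_mulVec (x : Fin N → ℝ) (i : Fin N) :
    ((G.LtMat * Matrix.diagonal fun i => (G.Is i)⁻¹) *ᵥ x) i
      = x i - (∑ j, G.Is j)⁻¹ * (∑ j, x j) * G.Is i := by
  have hne : ∀ j, G.Is j ≠ 0 := fun j => (G.Is_pos j).ne'
  rw [← Matrix.mulVec_mulVec, LtMat, Matrix.sub_mulVec, Matrix.smul_mulVec]
  simp only [Pi.sub_apply, Pi.smul_apply, smul_eq_mul, Matrix.mulVec_diagonal]
  rw [mul_inv_cancel_left₀ (hne i), Matrix.vecMulVec_mulVec]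
  have : (G.Is ⬝ᵥ (Matrix.diagonal fun i => (G.Is i)⁻¹) *ᵥ x) = ∑ j, x j := by
    simp only [dotProduct, Matrix.mulVec_diagonal]
    exact Finset.sum_congr rfl fun j _ => mul_inv_cancel_left₀ (hne j) _
  simp only [this, Pi.smul_apply, MulOpposite.smul_eq_mul_unop, MulOpposite.unop_op]
  ring

variable {G K}

theorem AdmissibleGains.alpha_neg (hK : G.AdmissibleGains K) (i : Fin N) : G.alpha K i < 0 :=
  div_neg_of_neg_of_pos (sub_neg.2 (hK.k₁_lt i)) (G.Lt_pos i)

theorem AdmissibleGains.beta_neg (hK : G.AdmissibleGains K) (i : Fin N) : G.beta K i < 0 :=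
  div_neg_of_neg_of_pos (sub_neg.2 (hK.k₂_lt i)) (G.Lt_pos i)

theorem AdmissibleGains.gamma_pos (hK : G.AdmissibleGains K) (i : Fin N) : 0 < G.gamma K i :=
  div_pos (hK.k₃_pos i) (G.Lt_pos i)

theorem AdmissibleGains.gamma_lt (hK : G.AdmissibleGains K) (i : Fin N) :
    G.gamma K i < G.alpha K i * G.beta K i := by
  have h : G.alpha K i * G.beta K i
      = 1 / G.Lt i * ((K.k₁ i - 1) * (K.k₂ i - G.Rt i)) / G.Lt i := by
    rw [alpha, beta]
    ring
  rw [h, gamma]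
  exact div_lt_div_of_pos_right (hK.k₃_lt i) (G.Lt_pos i)

theorem delta_eq_alpha (hk₄ : ∀ i, K.k₄ i = K.k₁ i - 1) (i : Fin N) :
    G.delta K i = G.alpha K i := by rw [delta, alpha, hk₄]

/-- Every positive power-flow solution is the voltage profile of an equilibrium. -/
theorem IsPositivePowerFlowSolution.exists_equilibrium {Vbar : Fin N → ℝ}
    (hV : G.IsPositivePowerFlowSolution Vbar) (hK : G.AdmissibleGains K) :
    ∃ Xbar : State N M, Xbar.voltage = Vbar ∧ G.closedLoop K Xbar = 0 := by
  have hIs : ∀ i, G.Is i ≠ 0 := fun i => (G.Is_pos i).ne'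
  -- The voltage balance is exactly the zero-sum condition for this right-hand side to lie in the
  -- range of the Laplacian.
  obtain ⟨Ω, hΩ⟩ := G.exists_commLap_eq (b := fun i => G.Is i * (G.Vref i - Vbar i)) (by
    simp only [mul_sub, Finset.sum_sub_distrib]
    rw [hV.balance, sub_self])
  have hω : ∀ i, G.omega Ω i = G.Vref i - Vbar i := fun i => by
    rw [omega, hΩ, inv_mul_cancel_left₀ (hIs i)]
  set κ := (∑ j, G.Is j)⁻¹ * ∑ j, G.loadCurrent Vbar j with hκ
  have hflow : ∀ i, (G.B *ᵥ fun l => (G.Bᵀ *ᵥ Vbar) l / G.R l) i + G.loadCurrent Vbar i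
      = κ * G.Is i := fun i => by
    have h := congrFun hV.flow i
    rw [Pi.add_apply, Le_mulVec, LtMat_mulVec, Pi.zero_apply] at h
    linarith
  refine ⟨(Vbar, fun i => κ * G.Is i, fun i => -(G.alpha K i * Vbar i + G.beta K i * (κ * G.Is i)
    + G.delta K i * G.omega Ω i) / G.gamma K i, fun l => (G.Bᵀ *ᵥ Vbar) l / G.R l, Ω), rfl, ?_⟩
  simp only [closedLoop, Prod.mk_eq_zero]
  refine ⟨?_, ?_, ?_, ?_, ?_⟩ <;> ext i
  · rw [← hflow]
    simp
  · have := (hK.gamma_pos i).ne'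
    simp only [Pi.zero_apply]
    field_simp
    ring
  · simp [hω]
  · simp [mul_div_cancel₀ _ (G.R_pos i).ne']
  · simp [commLap, mul_div_cancel_right₀ _ (hIs _)]

/-- The primary-controlled system has exactly one equilibrium. -/
theorem AdmissibleGains.existsUnique_equilibrium (hK : G.AdmissibleGains K) :
    ∃! Xbar' : PrimaryState N M, G.primaryLoop K Xbar' = 0 := by
  have hC : ∀ i, G.Ct i ≠ 0 := fun i => (G.Ct_pos i).ne'
  have hL : ∀ i, G.L i ≠ 0 := fun i => (G.L_pos i).ne'
  have hR : ∀ i, G.R i ≠ 0 := fun i => (G.R_pos i).ne'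
  have hγ : ∀ i, G.gamma K i ≠ 0 := fun i => (hK.gamma_pos i).ne'
  set I : Fin M → ℝ := fun l => (G.Bᵀ *ᵥ G.Vref) l / G.R l with hI
  set It : Fin N → ℝ := fun i => G.loadCurrent G.Vref i + (G.B *ᵥ I) i with hIt
  refine ⟨(G.Vref, It, fun i => -(G.alpha K i * G.Vref i + G.beta K i * It i) / G.gamma K i, I),
    ?_, ?_⟩
  · simp only [primaryLoop, Prod.mk_eq_zero]
    refine ⟨?_, ?_, ?_, ?_⟩ <;> ext i
    · simp [hIt]
    · have := hγ i
      simp only [Pi.zero_apply]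
      field_simp
      ring
    · simp
    · simp [hI, mul_div_cancel₀ _ (hR i)]
  · rintro ⟨V', It', v', I'⟩ h
    simp only [primaryLoop, Prod.mk_eq_zero] at h
    obtain ⟨h1, h2, h3, h4⟩ := h
    -- The equations are triangular at rest: the integrators fix `V`, the lines fix `I`, the nodes
    -- fix `It`, and `γ ≠ 0` fixes `v`.
    have e1 : V' = G.Vref := by
      ext i
      have := congrFun h3 i
      simp only [Pi.zero_apply] at this
      linarith
    subst e1
    have e4 : I' = I := by
      ext l
      have := congrFun h4 l
      simp only [Pi.zero_apply, div_eq_zero_iff, hL, or_false] at this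
      rw [hI]
      simp only
      rw [eq_div_iff (hR l)]
      linarith
    subst e4
    have e2 : It' = It := by
      ext i
      have := congrFun h1 i
      simp only [Pi.zero_apply, div_eq_zero_iff, hC, or_false] at this
      rw [hIt]
      simp only
      linarith
    subst e2
    refine Prod.ext rfl (Prod.ext rfl (Prod.ext ?_ rfl))
    ext i
    have := congrFun h2 i
    simp only [Pi.zero_apply] at this
    simp only
    rw [eq_div_iff (hγ i)]
    linarith

end Microgrid

/-- The state of the full system with the given primary state and vanishing consensus variables. -/
def PrimaryState.extend {N M : ℕ} : PrimaryState N M →L[ℝ] State N M :=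
  (ContinuousLinearMap.id ℝ (Fin N → ℝ)).prodMap <|
    (ContinuousLinearMap.id ℝ (Fin N → ℝ)).prodMap <|
      (ContinuousLinearMap.id ℝ (Fin N → ℝ)).prodMap <|
        (ContinuousLinearMap.id ℝ (Fin M → ℝ)).prod 0

namespace Microgrid

variable {N M : ℕ} (G : Microgrid N M) (K : Gains N)

/-! ### The Lyapunov function -/

/-- Coefficient of the squared filter current error in the Lyapunov function. -/
def currentWeight (i : Fin N) : ℝ :=
  -G.beta K i / (G.alpha K i * G.beta K i - G.gamma K i)

/-- Coefficient of the product of filter current and integrator errors in the Lyapunov function. -/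
def crossWeight (i : Fin N) : ℝ :=
  -G.gamma K i / (G.alpha K i * G.beta K i - G.gamma K i)

/-- The Lyapunov function, in the error coordinates. -/
def energy (ξ : State N M) : ℝ :=
  ∑ i, (G.Ct i * ξ.1 i ^ 2 + G.currentWeight K i * ξ.2.1 i ^ 2
      + 2 * G.crossWeight K i * (ξ.2.1 i * ξ.2.2.1 i)
      + G.alpha K i * G.crossWeight K i * ξ.2.2.1 i ^ 2 + ξ.2.2.2.2 i ^ 2) / 2
    + ∑ l, G.L l * ξ.2.2.2.1 l ^ 2 / 2

/-- The derivative of `energy` at `ξ` in the direction `η`. -/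
def energyDeriv (ξ η : State N M) : ℝ :=
  ∑ i, (G.Ct i * (ξ.1 i * η.1 i) + G.currentWeight K i * (ξ.2.1 i * η.2.1 i)
      + G.crossWeight K i * (ξ.2.1 i * η.2.2.1 i + ξ.2.2.1 i * η.2.1 i)
      + G.alpha K i * G.crossWeight K i * (ξ.2.2.1 i * η.2.2.1 i) + ξ.2.2.2.2 i * η.2.2.2.2 i)
    + ∑ l, G.L l * (ξ.2.2.2.1 l * η.2.2.2.1 l)

theorem energy_add_smul (ξ η : State N M) (t : ℝ) :
    G.energy K (ξ + t • η) = G.energy K ξ + t * G.energyDeriv K ξ η + t ^ 2 * G.energy K η := by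
  have hsum : ∀ {n : ℕ} (a b c : Fin n → ℝ), ∑ i, (a i + t * b i + t ^ 2 * c i)
      = ∑ i, a i + t * ∑ i, b i + t ^ 2 * ∑ i, c i := fun a b c => by
    simp only [Finset.sum_add_distrib, Finset.mul_sum]
  have hsplit : ∀ a a' b b' c c' : ℝ, a + a' + t * (b + b') + t ^ 2 * (c + c')
      = a + t * b + t ^ 2 * c + (a' + t * b' + t ^ 2 * c') := fun _ _ _ _ _ _ => by ring
  simp only [energy, energyDeriv, Prod.fst_add, Prod.snd_add, Prod.smul_fst, Prod.smul_snd,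
    Pi.add_apply, Pi.smul_apply, smul_eq_mul]
  rw [hsplit, ← hsum, ← hsum]
  congr 1 <;> exact Finset.sum_congr rfl fun i _ => by ring

theorem energy_smul (t : ℝ) (ξ : State N M) : G.energy K (t • ξ) = t ^ 2 * G.energy K ξ := by
  have h := G.energy_add_smul K 0 ξ t
  have h0 : G.energy K (0 : State N M) = 0 := by simp [energy]
  have h1 : G.energyDeriv K (0 : State N M) ξ = 0 := by simp [energyDeriv]
  simpa [h0, h1] using h

theorem differentiable_energy : Differentiable ℝ (G.energy K : State N M → ℝ) := by
  unfold energy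
  fun_prop

/-- On the line `ξ + t • η` the energy is a quadratic polynomial in `t`, and its linear coefficient
is the derivative. -/
theorem fderiv_energy (ξ η : State N M) : fderiv ℝ (G.energy K) ξ η = G.energyDeriv K ξ η := by
  have hline : HasDerivAt (fun t : ℝ => ξ + t • η) η 0 := by
    simpa using ((hasDerivAt_id (0 : ℝ)).smul_const η).const_add ξ
  have h1 : HasDerivAt (fun t : ℝ => G.energy K (ξ + t • η)) (fderiv ℝ (G.energy K) ξ η) 0 := by
    have h := (G.differentiable_energy K (ξ + (0 : ℝ) • η)).hasFDerivAt.comp_hasDerivAt 0 hline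
    simpa [Function.comp_def] using h
  have h2 : HasDerivAt (fun t : ℝ => G.energy K (ξ + t • η)) (G.energyDeriv K ξ η) 0 := by
    simp only [energy_add_smul]
    have := (((hasDerivAt_id (0 : ℝ)).mul_const (G.energyDeriv K ξ η)).const_add
      (G.energy K ξ)).add (((hasDerivAt_id (0 : ℝ)).pow 2).mul_const (G.energy K η))
    simpa [Pi.add_def] using this
  exact h1.unique h2

/-- The rate at which the Lyapunov function centred at `Xbar` decreases. -/
def dissipation (Xbar X : State N M) : ℝ :=
  ∑ i, ((X.1 i - Xbar.1 i) * (G.loadCurrent X.1 i - G.loadCurrent Xbar.1 i)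
      + -(G.currentWeight K i / G.beta K i) * (G.beta K i * (X.2.1 i - Xbar.2.1 i)
        + G.gamma K i * (X.2.2.1 i - Xbar.2.2.1 i)) ^ 2)
    + ∑ l, G.R l * (X.2.2.2.1 l - Xbar.2.2.2.1 l) ^ 2

variable {G K}

theorem AdmissibleGains.currentWeight_pos (hK : G.AdmissibleGains K) (i : Fin N) :
    0 < G.currentWeight K i :=
  div_pos (neg_pos.2 (hK.beta_neg i)) (sub_pos.2 (hK.gamma_lt i))

theorem AdmissibleGains.crossWeight_neg (hK : G.AdmissibleGains K) (i : Fin N) :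
    G.crossWeight K i < 0 :=
  div_neg_of_neg_of_pos (neg_neg_of_pos (hK.gamma_pos i)) (sub_pos.2 (hK.gamma_lt i))

theorem AdmissibleGains.crossWeight_eq (hK : G.AdmissibleGains K) (i : Fin N) :
    G.crossWeight K i = 1 + G.currentWeight K i * G.alpha K i := by
  have := (sub_pos.2 (hK.gamma_lt i)).ne'
  rw [crossWeight, currentWeight]
  field_simp
  ring

theorem currentWeight_mul_gamma (i : Fin N) :
    G.currentWeight K i * G.gamma K i = G.crossWeight K i * G.beta K i := by
  rw [crossWeight, currentWeight]
  ring

/-- Completing the square in each `(y, z)` block leaves `-q z²` with `q < 0`; every other term is a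
positive multiple of a square. -/
theorem AdmissibleGains.energy_pos (hK : G.AdmissibleGains K) {ξ : State N M} (hξ : ξ ≠ 0) :
    0 < G.energy K ξ := by
  have hnode : ∀ (i : Fin N) (y z : ℝ), 0 ≤ G.currentWeight K i * y ^ 2
      + 2 * G.crossWeight K i * (y * z) + G.alpha K i * G.crossWeight K i * z ^ 2 ∧
      (G.currentWeight K i * y ^ 2
      + 2 * G.crossWeight K i * (y * z) + G.alpha K i * G.crossWeight K i * z ^ 2 = 0 →
        y = 0 ∧ z = 0) := by
    intro i y z
    have hp := hK.currentWeight_pos i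
    have hq := hK.crossWeight_neg i
    have hpq := hK.crossWeight_eq i
    set p := G.currentWeight K i
    set q := G.crossWeight K i
    have key : p * (p * y ^ 2 + 2 * q * (y * z) + G.alpha K i * q * z ^ 2)
        = (p * y + q * z) ^ 2 + -q * z ^ 2 := by
      have : p * G.alpha K i = q - 1 := by linarith
      linear_combination q * z ^ 2 * this
    have h1 : 0 ≤ (p * y + q * z) ^ 2 := sq_nonneg _
    have h2 : 0 ≤ -q * z ^ 2 := mul_nonneg (neg_pos.2 hq).le (sq_nonneg _)
    refine ⟨nonneg_of_mul_nonneg_right (by rw [key]; exact add_nonneg h1 h2) hp, fun h => ?_⟩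
    rw [h, mul_zero] at key
    have hz : z = 0 := by
      have : -q * z ^ 2 = 0 := by linarith
      simpa [hq.ne] using this
    have hy : p * y + q * z = 0 := by
      have : (p * y + q * z) ^ 2 = 0 := by linarith
      simpa using this
    rw [hz, mul_zero, add_zero] at hy
    exact ⟨(mul_eq_zero.1 hy).resolve_left hp.ne', hz⟩
  have hC : ∀ i, 0 ≤ G.Ct i * ξ.1 i ^ 2 := fun i => mul_nonneg (G.Ct_pos i).le (sq_nonneg _)
  have hL : ∀ l, 0 ≤ G.L l * ξ.2.2.2.1 l ^ 2 / 2 := fun l =>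
    div_nonneg (mul_nonneg (G.L_pos l).le (sq_nonneg _)) two_pos.le
  have hterm : ∀ i, 0 ≤ (G.Ct i * ξ.1 i ^ 2 + G.currentWeight K i * ξ.2.1 i ^ 2
      + 2 * G.crossWeight K i * (ξ.2.1 i * ξ.2.2.1 i)
      + G.alpha K i * G.crossWeight K i * ξ.2.2.1 i ^ 2 + ξ.2.2.2.2 i ^ 2) / 2 := fun i => by
    linarith [hC i, (hnode i (ξ.2.1 i) (ξ.2.2.1 i)).1, sq_nonneg (ξ.2.2.2.2 i)]
  have hs1 := Finset.sum_nonneg fun i (_ : i ∈ Finset.univ) => hterm i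
  have hs2 := Finset.sum_nonneg fun l (_ : l ∈ Finset.univ) => hL l
  refine lt_of_le_of_ne (add_nonneg hs1 hs2) fun h0 => hξ ?_
  rw [energy] at h0
  have z1 := (Finset.sum_eq_zero_iff_of_nonneg fun i _ => hterm i).1
    (le_antisymm (by linarith) hs1)
  have z2 := (Finset.sum_eq_zero_iff_of_nonneg fun l _ => hL l).1
    (le_antisymm (by linarith) hs2)
  have hcomp : ∀ i, ξ.1 i = 0 ∧ ξ.2.1 i = 0 ∧ ξ.2.2.1 i = 0 ∧ ξ.2.2.2.2 i = 0 := fun i => by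
    have h1 := z1 i (Finset.mem_univ i)
    have h2 := hC i
    obtain ⟨h3, h4⟩ := hnode i (ξ.2.1 i) (ξ.2.2.1 i)
    have h5 := sq_nonneg (ξ.2.2.2.2 i)
    have h6 : G.Ct i * ξ.1 i ^ 2 = 0 := by linarith
    have h7 : ξ.2.2.2.2 i ^ 2 = 0 := by linarith
    obtain ⟨h8, h9⟩ := h4 (by linarith)
    exact ⟨by simpa [(G.Ct_pos i).ne'] using h6, h8, h9, by simpa using h7⟩
  refine Prod.ext ?_ (Prod.ext ?_ (Prod.ext ?_ (Prod.ext ?_ ?_))) <;> ext i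
  · exact (hcomp i).1
  · exact (hcomp i).2.1
  · exact (hcomp i).2.2.1
  · simpa [(G.L_pos i).ne'] using z2 i (Finset.mem_univ i)
  · exact (hcomp i).2.2.2

theorem AdmissibleGains.exists_energy_lower (hK : G.AdmissibleGains K) :
    ∃ c > 0, ∀ ξ : State N M, c * ‖ξ‖ ^ 2 ≤ G.energy K ξ :=
  exists_pos_mul_norm_sq_le (G.differentiable_energy K).continuous (G.energy_smul K)
    fun _ => hK.energy_pos

/-- The dissipation identity. -/
theorem AdmissibleGains.energyDeriv_sub (hK : G.AdmissibleGains K)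
    (hk₄ : ∀ i, K.k₄ i = K.k₁ i - 1) (Xbar X : State N M) :
    G.energyDeriv K (X - Xbar) (G.closedLoop K X - G.closedLoop K Xbar)
      = -G.dissipation K Xbar X := by
  obtain ⟨V, It, v, I, Ω⟩ := X
  obtain ⟨Vb, Itb, vb, Ib, Ωb⟩ := Xbar
  simp only [energyDeriv, dissipation, closedLoop, Prod.mk_sub_mk, Pi.sub_apply,
    delta_eq_alpha hk₄]
  have hI := G.sum_mul_mulVec_B (V - Vb) (I - Ib)
  simp only [Matrix.mulVec_sub, Pi.sub_apply] at hI
  -- Self-adjointness turns the consensus contribution into `ω · y`, which the node terms cancel.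
  have hΩ := G.sum_mul_commLap_comm (Ω - Ωb) ((fun j => It j / G.Is j) - fun j => Itb j / G.Is j)
  simp only [commLap_sub, Pi.sub_apply] at hΩ
  have hω : ∑ i, (Ω i - Ωb i) * (G.commLap (fun j => It j / G.Is j) i
      - G.commLap (fun j => Itb j / G.Is j) i)
      = ∑ i, (G.omega Ω i - G.omega Ωb i) * (It i - Itb i) := by
    rw [hΩ]
    refine Finset.sum_congr rfl fun i _ => ?_
    rw [omega, omega]
    ring
  have hlines : ∑ l, G.L l * ((I l - Ib l) * (((G.Bᵀ *ᵥ V) l - G.R l * I l) / G.L l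
      - ((G.Bᵀ *ᵥ Vb) l - G.R l * Ib l) / G.L l))
      = ∑ l, (I l - Ib l) * ((G.Bᵀ *ᵥ V) l - (G.Bᵀ *ᵥ Vb) l) - ∑ l, G.R l * (I l - Ib l) ^ 2 := by
    rw [← Finset.sum_sub_distrib]
    refine Finset.sum_congr rfl fun l _ => ?_
    have := (G.L_pos l).ne'
    field_simp
    ring
  rw [hlines, ← hI, Finset.sum_add_distrib, hω]
  have hnodes : ∀ i, G.Ct i * ((V i - Vb i) * ((It i - G.loadCurrent V i - (G.B *ᵥ I) i) / G.Ct i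
        - (Itb i - G.loadCurrent Vb i - (G.B *ᵥ Ib) i) / G.Ct i))
      + G.currentWeight K i * ((It i - Itb i) * (G.alpha K i * V i + G.beta K i * It i
          + G.gamma K i * v i + G.alpha K i * G.omega Ω i
        - (G.alpha K i * Vb i + G.beta K i * Itb i + G.gamma K i * vb i
          + G.alpha K i * G.omega Ωb i)))
      + G.crossWeight K i * ((It i - Itb i) * (G.Vref i - V i - G.omega Ω i
          - (G.Vref i - Vb i - G.omega Ωb i))
        + (v i - vb i) * (G.alpha K i * V i + G.beta K i * It i
          + G.gamma K i * v i + G.alpha K i * G.omega Ω i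
        - (G.alpha K i * Vb i + G.beta K i * Itb i + G.gamma K i * vb i
          + G.alpha K i * G.omega Ωb i)))
      + G.alpha K i * G.crossWeight K i * ((v i - vb i) * (G.Vref i - V i - G.omega Ω i
          - (G.Vref i - Vb i - G.omega Ωb i)))
      = -((V i - Vb i) * (G.loadCurrent V i - G.loadCurrent Vb i)
          + -(G.currentWeight K i / G.beta K i) * (G.beta K i * (It i - Itb i)
            + G.gamma K i * (v i - vb i)) ^ 2)
        - (V i - Vb i) * ((G.B *ᵥ I) i - (G.B *ᵥ Ib) i)
        - (G.omega Ω i - G.omega Ωb i) * (It i - Itb i) := by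
    intro i
    have hC := (G.Ct_pos i).ne'
    have hβ := (hK.beta_neg i).ne
    have hpq := hK.crossWeight_eq i
    have hpg := currentWeight_mul_gamma (G := G) (K := K) i
    have hcap : ∀ a b : ℝ, G.Ct i * ((V i - Vb i) * (a / G.Ct i - b / G.Ct i))
        = (V i - Vb i) * (a - b) := fun a b => by field_simp
    -- Since `p γ = q β`, the remaining form in `(y, z)` has rank one and is a perfect square.
    have hsq : ∀ y z : ℝ, -(G.currentWeight K i / G.beta K i)
        * (G.beta K i * y + G.gamma K i * z) ^ 2
        = -(G.currentWeight K i * G.beta K i * y ^ 2 + 2 * (G.currentWeight K i * G.gamma K i)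
          * (y * z) + G.crossWeight K i * G.gamma K i * z ^ 2) := fun y z => by
      have : G.crossWeight K i = G.currentWeight K i * G.gamma K i / G.beta K i := by
        rw [hpg, mul_div_cancel_right₀ _ hβ]
      rw [this]
      field_simp
      ring
    rw [hcap, hsq]
    linear_combination (-(It i - Itb i) * (V i - Vb i + (G.omega Ω i - G.omega Ωb i))) * hpq
      - (It i - Itb i) * (v i - vb i) * hpg
  rw [Finset.sum_congr rfl fun i _ => hnodes i]
  simp only [Finset.sum_sub_distrib, Finset.sum_neg_distrib]
  ring

end Microgrid

/-! ### Auxiliary limits and a chain rule -/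

theorem tendsto_zero_of_mul_sq_le {ι : Type*} {F : Filter ι} {u D : ι → ℝ} {k : ℝ} (hk : 0 < k)
    (hle : ∀ᶠ t in F, k * u t ^ 2 ≤ D t) (hD : Tendsto D F (𝓝 0)) : Tendsto u F (𝓝 0) := by
  have h1 : Tendsto (fun t => u t ^ 2) F (𝓝 0) := by
    have hD' : Tendsto (fun t => k⁻¹ * D t) F (𝓝 0) := by simpa using hD.const_mul k⁻¹
    refine tendsto_of_tendsto_of_tendsto_of_le_of_le' tendsto_const_nhds hD'
      (Eventually.of_forall fun t => sq_nonneg _) ?_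
    filter_upwards [hle] with t ht
    rw [inv_mul_eq_div, le_div_iff₀ hk]
    linarith
  have h2 : Tendsto (fun t => |u t|) F (𝓝 0) := by
    have := (Real.continuous_sqrt.tendsto 0).comp h1
    simpa [Function.comp_def, Real.sqrt_sq_eq_abs] using this
  exact (tendsto_zero_iff_abs_tendsto_zero u).2 h2

theorem tendsto_of_tendsto_sub_zero {ι : Type*} {F : Filter ι} {u : ι → ℝ} {a : ℝ}
    (h : Tendsto (fun t => u t - a) F (𝓝 0)) : Tendsto u F (𝓝 a) := by
  simpa using h.add_const a

theorem fderiv_comp_clm_sub {E F : Type*} [NormedAddCommGroup E] [NormedSpace ℝ E]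
    [NormedAddCommGroup F] [NormedSpace ℝ F] {W : F → ℝ} (hW : Differentiable ℝ W) (A : E →L[ℝ] F)
    (a x v : E) : fderiv ℝ (fun y => W (A (y - a))) x v = fderiv ℝ W (A (x - a)) (A v) := by
  have h1 : HasFDerivAt (fun y => A (y - a)) A x :=
    A.hasFDerivAt.comp x ((hasFDerivAt_id x).sub_const a)
  exact congrArg (· v) ((hW (A (x - a))).hasFDerivAt.comp x h1).fderiv

namespace Microgrid

variable {N M : ℕ} (G : Microgrid N M) (K : Gains N)

/-! ### Strictly increasing load currents -/

/-- Within distance `ρ` of `Vbar`, the load currents are continuously differentiable and grow from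
their values at `Vbar` at least with slope `c`. -/
structure IsRegularLoad (Vbar : Fin N → ℝ) (c ρ : ℝ) : Prop where
  pos : 0 < c
  slope : ∀ V, dist V Vbar ≤ ρ → ∀ i, c * (V i - Vbar i) ^ 2
    ≤ (V i - Vbar i) * (G.loadCurrent V i - G.loadCurrent Vbar i)
  contDiffAt : ∀ V, dist V Vbar ≤ ρ → ContDiffAt ℝ 1 G.loadCurrent V

theorem exists_pos_le_of_pos {d : Fin N → ℝ} (hd : ∀ i, 0 < d i) :
    ∃ c > 0, ∀ i, c ≤ d i := by
  rcases isEmpty_or_nonempty (Fin N) with _ | _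
  · exact ⟨1, one_pos, fun i => isEmptyElim i⟩
  · obtain ⟨i, hi⟩ := Finite.exists_min d
    exact ⟨d i, hd i, hi⟩

/-- The linearisation error is eventually at most `d / 2 * |v - a|`, so half the slope survives. -/
theorem _root_.HasDerivAt.eventually_half_mul_sq_le {h : ℝ → ℝ} {d a : ℝ} (hd : 0 < d)
    (hh : HasDerivAt h d a) :
    ∀ᶠ v in 𝓝 a, d / 2 * (v - a) ^ 2 ≤ (v - a) * (h v - h a) := by
  have h1 := hh.isLittleO.def (half_pos hd)
  filter_upwards [h1] with v hv
  simp only [smul_eq_mul, Real.norm_eq_abs] at hv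
  have h2 : |(v - a) * (h v - h a - (v - a) * d)| ≤ d / 2 * (v - a) ^ 2 := by
    rw [abs_mul, ← sq_abs (v - a)]
    nlinarith [mul_le_mul_of_nonneg_left hv (abs_nonneg (v - a))]
  nlinarith [(abs_le.1 h2).1]

variable {G}

/-- For `r < 1` the load condition is this inequality multiplied by `V²`. For `r = 1` the slope is
`YL`, and for `r > 1` the E load only adds to it. -/
theorem LoadCondition.slope_pos {V : Fin N → ℝ} (hload : G.LoadCondition V) (hV : ∀ i, 0 < V i)
    (hP : ∀ i, 1 < G.r i → 0 ≤ G.PL i) (i : Fin N) :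
    0 < G.YL i + (G.r i - 1) * V i ^ (G.r i - 1 - 1) * G.PL i := by
  have hY := G.YL_pos i
  rcases lt_trichotomy (G.r i) 1 with hr | hr | hr
  · have h := hload i hr
    have h2 : V i ^ G.r i = V i ^ (G.r i - 1 - 1) * V i ^ 2 := by
      rw [← Real.rpow_natCast (V i) 2, ← Real.rpow_add (hV i)]
      congr 1
      push_cast
      ring
    rw [ePower, h2] at h
    have h3 : 0 < V i ^ 2 := pow_pos (hV i) 2
    by_contra hcon
    push Not at hcon
    nlinarith
  · simpa [hr] using hY
  · have h1 : 0 ≤ (G.r i - 1) * V i ^ (G.r i - 1 - 1) * G.PL i :=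
      mul_nonneg (mul_nonneg (by linarith) (Real.rpow_nonneg (hV i).le _)) (hP i hr)
    linarith

theorem LoadCondition.exists_isRegularLoad {V : Fin N → ℝ} (hload : G.LoadCondition V)
    (hV : ∀ i, 0 < V i) (hP : ∀ i, 1 < G.r i → 0 ≤ G.PL i) :
    ∃ c, ∃ ρ > 0, G.IsRegularLoad V c ρ := by
  have hd := hload.slope_pos hV hP
  set d := fun i => G.YL i + (G.r i - 1) * V i ^ (G.r i - 1 - 1) * G.PL i with hddef
  obtain ⟨c, hc, hcd⟩ := exists_pos_le_of_pos fun i => half_pos (hd i)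
  have hder : ∀ i, HasDerivAt (fun v : ℝ => G.YL i * v + G.IL i + v ^ (G.r i - 1) * G.PL i)
      (d i) (V i) := fun i => by
    have h1 := ((hasDerivAt_id (V i)).const_mul (G.YL i)).add_const (G.IL i)
    have h2 := (Real.hasDerivAt_rpow_const (p := G.r i - 1) (Or.inl (hV i).ne')).mul_const (G.PL i)
    have h3 := h1.add h2
    simpa [hddef, Pi.add_def] using h3
  have hev : ∀ᶠ U in 𝓝 V, ∀ i, 0 < U i ∧ d i / 2 * (U i - V i) ^ 2
      ≤ (U i - V i) * (G.loadCurrent U i - G.loadCurrent V i) := by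
    refine eventually_all.2 fun i => ?_
    have hi : Tendsto (fun U : Fin N → ℝ => U i) (𝓝 V) (𝓝 (V i)) := (continuous_apply i).tendsto V
    exact (hi.eventually (lt_mem_nhds (hV i))).and
      (hi.eventually (HasDerivAt.eventually_half_mul_sq_le (hd i) (hder i)))
  obtain ⟨ε, hε, hball⟩ := Metric.eventually_nhds_iff.1 hev
  have hball' : ∀ U, dist U V ≤ ε / 2 → ∀ i, 0 < U i ∧ d i / 2 * (U i - V i) ^ 2
      ≤ (U i - V i) * (G.loadCurrent U i - G.loadCurrent V i) := fun U hU =>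
    hball (hU.trans_lt (half_lt_self hε))
  refine ⟨c, ε / 2, half_pos hε, hc, fun U hU i => ?_, fun U hU => ?_⟩
  · exact (mul_le_mul_of_nonneg_right (hcd i) (sq_nonneg _)).trans (hball' U hU i).2
  · refine contDiffAt_pi.2 fun i => ?_
    have h1 : ContDiffAt ℝ 1 (fun U : Fin N → ℝ => U i) U := contDiffAt_apply ..
    unfold loadCurrent
    exact ((contDiffAt_const.mul h1).add contDiffAt_const).add
      ((h1.rpow_const_of_ne (hball' U hU i).1.ne').mul contDiffAt_const)

/-- The load is affine, so one slope bound serves all radii; this is the source of the global claim.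
-/
theorem exists_isRegularLoad_of_PL_eq_zero (hPL : ∀ i, G.PL i = 0) (V : Fin N → ℝ) :
    ∃ c, ∀ ρ, G.IsRegularLoad V c ρ := by
  obtain ⟨c, hc, hcd⟩ := exists_pos_le_of_pos G.YL_pos
  have hlin : G.loadCurrent = fun U i => G.YL i * U i + G.IL i := by
    ext U i
    simp [loadCurrent, hPL]
  refine ⟨c, fun ρ => ⟨hc, fun U _ i => ?_, fun U _ => ?_⟩⟩
  · rw [hlin]
    have := mul_le_mul_of_nonneg_right (hcd i) (sq_nonneg (U i - V i))
    linarith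
  · rw [hlin]
    fun_prop

/-! ### Lyapunov functions of both systems -/

theorem dist_fst_le_of_dist_le {X Xbar : State N M} {ρ : ℝ} (h : dist X Xbar ≤ ρ) :
    dist X.1 Xbar.1 ≤ ρ := (le_max_left _ _).trans h

variable {K}

/-- All summands are nonnegative, so each is at most the total; a vanishing dissipation then forces
each error to vanish. -/
theorem AdmissibleGains.dissipation_bounds (hK : G.AdmissibleGains K) {Xbar X : State N M}
    {c ρ : ℝ} (hreg : G.IsRegularLoad Xbar.1 c ρ) (hX : dist X.1 Xbar.1 ≤ ρ) :
    0 ≤ G.dissipation K Xbar X ∧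
    (∀ i, c * (X.1 i - Xbar.1 i) ^ 2 ≤ G.dissipation K Xbar X) ∧
    (∀ i, -(G.currentWeight K i / G.beta K i) * (G.beta K i * (X.2.1 i - Xbar.2.1 i)
        + G.gamma K i * (X.2.2.1 i - Xbar.2.2.1 i)) ^ 2 ≤ G.dissipation K Xbar X) ∧
    ∀ l, G.R l * (X.2.2.2.1 l - Xbar.2.2.2.1 l) ^ 2 ≤ G.dissipation K Xbar X := by
  have h1 : ∀ i, 0 ≤ c * (X.1 i - Xbar.1 i) ^ 2 := fun i => mul_nonneg hreg.pos.le (sq_nonneg _)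
  have h2 := hreg.slope _ hX
  have h3 : ∀ i, 0 ≤ -(G.currentWeight K i / G.beta K i) * (G.beta K i * (X.2.1 i - Xbar.2.1 i)
      + G.gamma K i * (X.2.2.1 i - Xbar.2.2.1 i)) ^ 2 := fun i =>
    mul_nonneg (neg_nonneg.2 (div_nonpos_of_nonneg_of_nonpos (hK.currentWeight_pos i).le
      (hK.beta_neg i).le)) (sq_nonneg _)
  have h4 : ∀ l, 0 ≤ G.R l * (X.2.2.2.1 l - Xbar.2.2.2.1 l) ^ 2 := fun l =>
    mul_nonneg (G.R_pos l).le (sq_nonneg _)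
  have hterm : ∀ i, 0 ≤ (X.1 i - Xbar.1 i) * (G.loadCurrent X.1 i - G.loadCurrent Xbar.1 i)
      + -(G.currentWeight K i / G.beta K i) * (G.beta K i * (X.2.1 i - Xbar.2.1 i)
        + G.gamma K i * (X.2.2.1 i - Xbar.2.2.1 i)) ^ 2 := fun i => by
    linarith [h1 i, h2 i, h3 i]
  have hs1 := Finset.sum_nonneg fun i (_ : i ∈ Finset.univ) => hterm i
  have hs2 := Finset.sum_nonneg fun l (_ : l ∈ Finset.univ) => h4 l
  have hle := fun i => Finset.single_le_sum (fun j _ => hterm j) (Finset.mem_univ i)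
  have hle' := fun l => Finset.single_le_sum (fun j _ => h4 j) (Finset.mem_univ l)
  unfold dissipation
  refine ⟨add_nonneg hs1 hs2, fun i => ?_, fun i => ?_, fun l => ?_⟩
  · linarith [hle i, h2 i, h3 i]
  · linarith [hle i, h1 i, h2 i]
  · linarith [hle' l]

theorem contDiffAt_closedLoop {X : State N M} (hX : ContDiffAt ℝ 1 G.loadCurrent X.1) :
    ContDiffAt ℝ 1 (G.closedLoop K) X := by
  have hload : ∀ i, ContDiffAt ℝ 1 (fun Y : State N M => G.loadCurrent Y.1 i) X := fun i =>
    contDiffAt_pi.1 (hX.comp X contDiffAt_fst) i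
  unfold closedLoop omega commLap Matrix.mulVec dotProduct
  refine ContDiffAt.prodMk ?_ (ContDiffAt.prodMk ?_ (ContDiffAt.prodMk ?_ (ContDiffAt.prodMk ?_ ?_)))
  · refine contDiffAt_pi.2 fun i => ContDiffAt.div_const (ContDiffAt.sub
      (ContDiffAt.sub (by fun_prop) (hload i)) (by fun_prop)) _
  all_goals fun_prop

theorem primaryLoop_eq (X : PrimaryState N M) : G.primaryLoop K X
    = ((G.closedLoop K X.extend).1, (G.closedLoop K X.extend).2.1,
      (G.closedLoop K X.extend).2.2.1, (G.closedLoop K X.extend).2.2.2.1) := by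
  have h : G.omega (PrimaryState.extend X).2.2.2.2 = 0 := G.omega_zero
  ext i
  · rfl
  · change _ = _ + G.delta K i * G.omega (PrimaryState.extend X).2.2.2.2 i
    rw [h]
    simp [primaryLoop]
  · change _ = _ - G.omega (PrimaryState.extend X).2.2.2.2 i
    rw [h]
    simp [primaryLoop]
  · rfl

theorem contDiffAt_primaryLoop {X : PrimaryState N M} (hX : ContDiffAt ℝ 1 G.loadCurrent X.1) :
    ContDiffAt ℝ 1 (G.primaryLoop K) X := by
  have h : ContDiffAt ℝ 1 (fun Y : PrimaryState N M => G.closedLoop K Y.extend) X :=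
    (contDiffAt_closedLoop (K := K) (X := X.extend) hX).comp X
      PrimaryState.extend.contDiff.contDiffAt
  rw [funext (G.primaryLoop_eq (K := K))]
  exact h.fst.prodMk (h.snd.fst.prodMk (h.snd.snd.fst.prodMk h.snd.snd.snd.fst))

theorem AdmissibleGains.fderiv_energy_closedLoop (hK : G.AdmissibleGains K)
    (hk₄ : ∀ i, K.k₄ i = K.k₁ i - 1) {Xbar : State N M} (hXbar : G.closedLoop K Xbar = 0)
    (X : State N M) :
    fderiv ℝ (fun Y => G.energy K (Y - Xbar)) X (G.closedLoop K X)
      = -G.dissipation K Xbar X := by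
  have h := fderiv_comp_clm_sub (G.differentiable_energy K) (ContinuousLinearMap.id ℝ (State N M))
    Xbar X (G.closedLoop K X)
  simp only [ContinuousLinearMap.id_apply] at h
  rw [h, fderiv_energy, ← hK.energyDeriv_sub hk₄, hXbar, sub_zero]

/-- Extended states need not keep `Ω = 0` under the full dynamics, but the consensus error
multiplies that velocity in `energyDeriv` and is zero, so the dissipation identity still applies. -/
theorem AdmissibleGains.fderiv_energy_primaryLoop (hK : G.AdmissibleGains K)
    (hk₄ : ∀ i, K.k₄ i = K.k₁ i - 1) {Xbar : PrimaryState N M} (hXbar : G.primaryLoop K Xbar = 0)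
    (X : PrimaryState N M) :
    fderiv ℝ (fun Y : PrimaryState N M => G.energy K (Y - Xbar).extend) X (G.primaryLoop K X)
      = -G.dissipation K Xbar.extend X.extend := by
  rw [fderiv_comp_clm_sub (G.differentiable_energy K) PrimaryState.extend, fderiv_energy,
    ← hK.energyDeriv_sub hk₄, ← map_sub]
  rw [primaryLoop_eq] at hXbar ⊢
  simp only [Prod.mk_eq_zero] at hXbar
  obtain ⟨h1, h2, h3, h4⟩ := hXbar
  have h0 : ∀ i, (PrimaryState.extend (X - Xbar)).2.2.2.2 i = 0 := fun i => rfl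
  simp only [energyDeriv, h0, zero_mul, Prod.fst_sub, Prod.snd_sub, h1, h2, h3, h4, sub_zero]
  rfl

/-- The constant `c` depends on the energy alone and precedes the radius `ρ`; the global argument
needs this order to enlarge `ρ` with `c` fixed. -/
theorem AdmissibleGains.exists_isLyapunovFunctionOn_closedLoop (hK : G.AdmissibleGains K)
    (hk₄ : ∀ i, K.k₄ i = K.k₁ i - 1) {Xbar : State N M} (hXbar : G.closedLoop K Xbar = 0) :
    ∃ c > 0, ∀ c' ρ, G.IsRegularLoad Xbar.1 c' ρ → ODEStability.IsLyapunovFunctionOn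
      (G.closedLoop K) (fun X => G.energy K (X - Xbar)) Xbar c ρ := by
  obtain ⟨c, hc, hlow⟩ := hK.exists_energy_lower
  refine ⟨c, hc, fun c' ρ hreg => ⟨hc, ?_, ?_, fun X => ?_, fun X hX => ?_⟩⟩
  · exact (G.differentiable_energy K).comp (differentiable_id.sub_const Xbar)
  · simp [energy]
  · rw [dist_eq_norm]
    exact hlow _
  · rw [hK.fderiv_energy_closedLoop hk₄ hXbar]
    exact neg_nonpos.2 (hK.dissipation_bounds hreg (dist_fst_le_of_dist_le hX)).1

theorem norm_extend (X : PrimaryState N M) : ‖(X.extend : State N M)‖ = ‖X‖ := by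
  change max _ (max _ (max _ (max _ ‖(0 : Fin N → ℝ)‖))) = max _ (max _ (max _ _))
  rw [norm_zero, max_eq_left (norm_nonneg (PrimaryState.extend X).2.2.2.1)]
  rfl

theorem AdmissibleGains.exists_isLyapunovFunctionOn_primaryLoop (hK : G.AdmissibleGains K)
    (hk₄ : ∀ i, K.k₄ i = K.k₁ i - 1) {Xbar : PrimaryState N M}
    (hXbar : G.primaryLoop K Xbar = 0) :
    ∃ c > 0, ∀ c' ρ, G.IsRegularLoad Xbar.1 c' ρ → ODEStability.IsLyapunovFunctionOn
      (G.primaryLoop K) (fun X => G.energy K (X - Xbar).extend) Xbar c ρ := by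
  obtain ⟨c, hc, hlow⟩ := hK.exists_energy_lower
  refine ⟨c, hc, fun c' ρ hreg => ⟨hc, ?_, ?_, fun X => ?_, fun X hX => ?_⟩⟩
  · exact (G.differentiable_energy K).comp
      (PrimaryState.extend.differentiable.comp (differentiable_id.sub_const Xbar))
  · simp [energy]
  · rw [dist_eq_norm, ← norm_extend]
    exact hlow _
  · rw [hK.fderiv_energy_primaryLoop hk₄ hXbar]
    exact neg_nonpos.2 (hK.dissipation_bounds (Xbar := Xbar.extend) (X := X.extend) hreg
      ((le_max_left _ _).trans hX)).1

end Microgrid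

namespace Microgrid

variable {N M : ℕ} {G : Microgrid N M} {K : Gains N}

/-! ### Convergence -/

theorem AdmissibleGains.tendsto_of_dissipation (hK : G.AdmissibleGains K) {Xbar : State N M}
    {c ρ : ℝ} (hreg : G.IsRegularLoad Xbar.1 c ρ) {X : ℝ → State N M}
    (hball : ∀ᶠ t in atTop, dist (X t).1 Xbar.1 ≤ ρ)
    (hD : Tendsto (fun t => G.dissipation K Xbar (X t)) atTop (𝓝 0)) :
    Tendsto (fun t => (X t).1) atTop (𝓝 Xbar.1) ∧
    Tendsto (fun t => (X t).2.2.2.1) atTop (𝓝 Xbar.2.2.2.1) ∧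
    ∀ i, Tendsto (fun t => G.beta K i * ((X t).2.1 i - Xbar.2.1 i)
      + G.gamma K i * ((X t).2.2.1 i - Xbar.2.2.1 i)) atTop (𝓝 0) := by
  have hb := hball.mono fun t ht => hK.dissipation_bounds hreg ht
  refine ⟨tendsto_pi_nhds.2 fun i => ?_, tendsto_pi_nhds.2 fun l => ?_, fun i => ?_⟩
  · exact tendsto_of_tendsto_sub_zero
      (tendsto_zero_of_mul_sq_le hreg.pos (hb.mono fun t ht => ht.2.1 i) hD)
  · exact tendsto_of_tendsto_sub_zero
      (tendsto_zero_of_mul_sq_le (G.R_pos l) (hb.mono fun t ht => ht.2.2.2 l) hD)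
  · exact tendsto_zero_of_mul_sq_le
      (neg_pos.2 (div_neg_of_pos_of_neg (hK.currentWeight_pos i) (hK.beta_neg i)))
      (hb.mono fun t ht => ht.2.2.1 i) hD

/-- The capacitor equation expresses `It` through `V`, `I` and the derivative of `V`, all of which
converge; `γ ≠ 0` then recovers `v`. -/
theorem AdmissibleGains.tendsto_current_integrator (hK : G.AdmissibleGains K) {Xbar : State N M}
    {X : ℝ → State N M} (hcont : ContinuousAt G.loadCurrent Xbar.1)
    (hXbar : (G.closedLoop K Xbar).1 = 0) (hV : Tendsto (fun t => (X t).1) atTop (𝓝 Xbar.1))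
    (hI : Tendsto (fun t => (X t).2.2.2.1) atTop (𝓝 Xbar.2.2.2.1))
    (hyz : ∀ i, Tendsto (fun t => G.beta K i * ((X t).2.1 i - Xbar.2.1 i)
      + G.gamma K i * ((X t).2.2.1 i - Xbar.2.2.1 i)) atTop (𝓝 0))
    (hderiv : ∀ i, Tendsto (fun t => (G.closedLoop K (X t)).1 i) atTop (𝓝 0)) :
    Tendsto (fun t => (X t).2.1) atTop (𝓝 Xbar.2.1) ∧
    Tendsto (fun t => (X t).2.2.1) atTop (𝓝 Xbar.2.2.1) := by
  have hIt_eq : ∀ (Y : State N M) i, Y.2.1 i = G.Ct i * (G.closedLoop K Y).1 i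
      + G.loadCurrent Y.1 i + (G.B *ᵥ Y.2.2.2.1) i := fun Y i => by
    have : (G.closedLoop K Y).1 i
      = (Y.2.1 i - G.loadCurrent Y.1 i - (G.B *ᵥ Y.2.2.2.1) i) / G.Ct i := rfl
    rw [this, mul_div_cancel₀ _ (G.Ct_pos i).ne']
    ring
  have hIt : ∀ i, Tendsto (fun t => (X t).2.1 i) atTop (𝓝 (Xbar.2.1 i)) := fun i => by
    rw [hIt_eq Xbar i, hXbar]
    simp only [hIt_eq (X _) i]
    refine (((hderiv i).const_mul (G.Ct i)).add ?_).add ?_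
    · exact tendsto_pi_nhds.1 (hcont.tendsto.comp hV) i
    · have hB : Continuous fun w : Fin M → ℝ => (G.B *ᵥ w) i := by
        unfold Matrix.mulVec dotProduct
        fun_prop
      exact (hB.tendsto _).comp hI
  refine ⟨tendsto_pi_nhds.2 hIt, tendsto_pi_nhds.2 fun i => tendsto_of_tendsto_sub_zero ?_⟩
  have hγ := (hK.gamma_pos i).ne'
  have h := ((hyz i).sub (((hIt i).sub_const (Xbar.2.1 i)).const_mul (G.beta K i))).const_mul
    (G.gamma K i)⁻¹
  simp only [sub_self, mul_zero] at h
  refine h.congr fun t => ?_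
  rw [add_sub_cancel_left, inv_mul_cancel_left₀ hγ]

/-- The filter current equation can be solved for `ω` because `δ = α ≠ 0`. -/
theorem AdmissibleGains.tendsto_commLap (hK : G.AdmissibleGains K)
    (hk₄ : ∀ i, K.k₄ i = K.k₁ i - 1) {Xbar : State N M} {X : ℝ → State N M}
    (hXbar : (G.closedLoop K Xbar).2.1 = 0) (hV : Tendsto (fun t => (X t).1) atTop (𝓝 Xbar.1))
    (hIt : Tendsto (fun t => (X t).2.1) atTop (𝓝 Xbar.2.1))
    (hv : Tendsto (fun t => (X t).2.2.1) atTop (𝓝 Xbar.2.2.1))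
    (hderiv : ∀ i, Tendsto (fun t => (G.closedLoop K (X t)).2.1 i) atTop (𝓝 0)) :
    Tendsto (fun t => G.commLap (X t).2.2.2.2) atTop (𝓝 (G.commLap Xbar.2.2.2.2)) := by
  refine tendsto_pi_nhds.2 fun i => ?_
  have hα := (hK.alpha_neg i).ne
  have heq : ∀ Y : State N M, G.commLap Y.2.2.2.2 i = G.Is i * ((G.alpha K i)⁻¹ *
      ((G.closedLoop K Y).2.1 i - G.alpha K i * Y.1 i - G.beta K i * Y.2.1 i
        - G.gamma K i * Y.2.2.1 i)) := fun Y => by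
    have : (G.closedLoop K Y).2.1 i = G.alpha K i * Y.1 i + G.beta K i * Y.2.1 i
      + G.gamma K i * Y.2.2.1 i + G.delta K i * G.omega Y.2.2.2.2 i := rfl
    have hIs := (G.Is_pos i).ne'
    rw [this, delta_eq_alpha hk₄, omega]
    field_simp
    ring
  rw [heq Xbar, hXbar]
  simp only [heq (X _)]
  exact (((((hderiv i).sub ((tendsto_pi_nhds.1 hV i).const_mul _)).sub
    ((tendsto_pi_nhds.1 hIt i).const_mul _)).sub
    ((tendsto_pi_nhds.1 hv i).const_mul _)).const_mul _).const_mul _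

theorem continuousOn_dissipation {Xbar : State N M} {c ρ : ℝ}
    (hreg : G.IsRegularLoad Xbar.1 c ρ) :
    ContinuousOn (G.dissipation K Xbar) {X | dist X.1 Xbar.1 ≤ ρ} := by
  intro X hX
  refine ContinuousAt.continuousWithinAt ?_
  have hload : ∀ i, ContinuousAt (fun Y : State N M => G.loadCurrent Y.1 i) X := fun i =>
    continuousAt_pi.1 ((hreg.contDiffAt _ hX).continuousAt.comp continuousAt_fst) i
  unfold dissipation
  refine ContinuousAt.add (tendsto_finsetSum _ fun i _ => ContinuousAt.add
    (ContinuousAt.mul (by fun_prop) ((hload i).sub continuousAt_const)) (by fun_prop)) (by fun_prop)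

theorem sum_consensus_eq {s : Set ℝ} (hs : Convex ℝ s) (h0 : (0 : ℝ) ∈ s) {X : ℝ → State N M}
    (hX : IsIntegralCurveOn X (fun _ => G.closedLoop K) s) {t : ℝ} (ht : t ∈ s) :
    ∑ i, (X t).consensus i = ∑ i, (X 0).consensus i := by
  have hder : ∀ τ ∈ s, HasDerivWithinAt (fun τ => ∑ i, (X τ).consensus i) 0 s τ := fun τ hτ => by
    have h1 : HasDerivWithinAt (fun τ => (X τ).2.2.2.2) (G.closedLoop K (X τ)).2.2.2.2 s τ :=
      (hX τ hτ).snd.snd.snd.snd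
    have h2 := HasDerivWithinAt.fun_sum fun i (_ : i ∈ Finset.univ) => hasDerivWithinAt_pi.1 h1 i
    have h3 : ∑ i, (G.closedLoop K (X τ)).2.2.2.2 i = 0 := G.sum_commLap _
    rwa [h3] at h2
  have h := Convex.norm_image_sub_le_of_norm_hasDerivWithin_le hder (C := 0)
    (fun _ _ => by simp) hs h0 ht
  rw [zero_mul, norm_le_zero_iff, sub_eq_zero] at h
  exact h

theorem isForwardInvariant_leaf (Xbar : State N M) :
    ODEStability.IsForwardInvariant (G.closedLoop K) Xbar.leaf := fun T _ hT hX h0 _ ht =>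
  (sum_consensus_eq (convex_Ico 0 T) ⟨le_rfl, hT⟩ hX ht).trans h0

theorem _root_.State.shiftTo_eq_self {Xbar X₀ : State N M} (h : X₀ ∈ Xbar.leaf) :
    Xbar.shiftTo X₀ = Xbar := by
  have h' : ∑ i, (X₀.consensus i - Xbar.consensus i) = 0 := by
    rw [Finset.sum_sub_distrib, sub_eq_zero]
    exact h
  refine Prod.ext rfl (Prod.ext rfl (Prod.ext rfl (Prod.ext rfl ?_)))
  ext i
  simp only [State.shiftTo, h', zero_div, add_zero]
  rfl

/-- Solutions of the closed loop that stay in a region of regular loads converge. -/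
theorem AdmissibleGains.tendsto_shiftTo (hK : G.AdmissibleGains K)
    (hk₄ : ∀ i, K.k₄ i = K.k₁ i - 1) {Xbar : State N M} (hXbar : G.closedLoop K Xbar = 0)
    {c c' ρ : ℝ} (hρ : 0 ≤ ρ) (hreg : G.IsRegularLoad Xbar.1 c' ρ)
    (hW : ODEStability.IsLyapunovFunctionOn (G.closedLoop K) (fun X => G.energy K (X - Xbar))
      Xbar c ρ) {X : ℝ → State N M}
    (hX : IsIntegralCurveOn X (fun _ => G.closedLoop K) (Ici 0))
    (hball : ∀ t, 0 ≤ t → dist (X t) Xbar ≤ ρ) :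
    Tendsto X atTop (𝓝 (Xbar.shiftTo (X 0))) := by
  have hf : ContinuousOn (G.closedLoop K) (closedBall Xbar ρ) := fun Y hY =>
    (contDiffAt_closedLoop (hreg.contDiffAt _
      (dist_fst_le_of_dist_le hY))).continuousAt.continuousWithinAt
  have hsub : closedBall Xbar ρ ⊆ {Y | dist Y.1 Xbar.1 ≤ ρ} := fun Y hY => dist_fst_le_of_dist_le hY
  obtain ⟨l, hl⟩ := hW.exists_tendsto hX hball
  -- Barbalat applied to the energy, whose derivative along the solution is minus the dissipation.
  have hD : Tendsto (fun t => G.dissipation K Xbar (X t)) atTop (𝓝 0) := by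
    have := ODEStability.tendsto_zero_along_integralCurve hf hX hball
      ((continuousOn_dissipation (K := K) hreg).mono hsub).neg
      (fun t ht => by
        have h := ODEStability.hasDerivWithinAt_comp_integralCurve hW.differentiable hX ht
        rwa [hK.fderiv_energy_closedLoop hk₄ hXbar] at h) hl
    simpa using this.neg
  obtain ⟨hV, hI, hyz⟩ := hK.tendsto_of_dissipation hreg
    ((eventually_ge_atTop 0).mono fun t ht => dist_fst_le_of_dist_le (hball t ht)) hD
  have hVder : ∀ i, Tendsto (fun t => (G.closedLoop K (X t)).1 i) atTop (𝓝 0) := fun i =>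
    ODEStability.tendsto_zero_along_integralCurve hf hX hball
      (g := fun Y => (G.closedLoop K Y).1 i)
      ((continuous_apply i).comp_continuousOn (continuous_fst.comp_continuousOn hf))
      (fun t ht => hasDerivWithinAt_pi.1 (hX t ht).fst i) (tendsto_pi_nhds.1 hV i)
  obtain ⟨hIt, hv⟩ := hK.tendsto_current_integrator
    (hreg.contDiffAt _ (by rwa [dist_self])).continuousAt (by rw [hXbar]; rfl) hV hI hyz hVder
  have hItder : ∀ i, Tendsto (fun t => (G.closedLoop K (X t)).2.1 i) atTop (𝓝 0) := fun i =>
    ODEStability.tendsto_zero_along_integralCurve hf hX hball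
      (g := fun Y => (G.closedLoop K Y).2.1 i)
      ((continuous_apply i).comp_continuousOn
        (continuous_fst.comp_continuousOn (continuous_snd.comp_continuousOn hf)))
      (fun t ht => hasDerivWithinAt_pi.1 (hX t ht).snd.fst i) (tendsto_pi_nhds.1 hIt i)
  have hlap := hK.tendsto_commLap hk₄ (by rw [hXbar]; rfl) hV hIt hv hItder
  have hΩ : Tendsto (fun t => (X t).2.2.2.2) atTop (𝓝 (Xbar.shiftTo (X 0)).2.2.2.2) := by
    -- The shift is chosen so that this difference has zero sum at all times `t ≥ 0`, by
    -- conservation of `∑ Ω`.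
    have hz : Tendsto (fun t => (X t).2.2.2.2 - (Xbar.shiftTo (X 0)).2.2.2.2) atTop (𝓝 0) := by
      refine G.tendsto_zero_of_commLap ?_ ?_
      · filter_upwards [eventually_ge_atTop 0] with t ht
        have hN : (N : ℝ) ≠ 0 := by exact_mod_cast G.card_pos.ne'
        have h := sum_consensus_eq (convex_Ici 0) self_mem_Ici hX ht
        simp only [State.consensus] at h
        simp only [Pi.sub_apply, State.shiftTo, State.consensus, Finset.sum_sub_distrib, h,
          Finset.sum_add_distrib, Finset.sum_const, Finset.card_univ, Fintype.card_fin,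
          nsmul_eq_mul]
        rw [mul_div_cancel₀ _ hN]
        ring
      · have hshift : G.commLap (Xbar.shiftTo (X 0)).2.2.2.2 = G.commLap Xbar.2.2.2.2 :=
          G.commLap_add_const _ _
        simp only [commLap_sub, hshift]
        simpa using hlap.sub_const (G.commLap Xbar.2.2.2.2)
    simpa using hz.add_const (Xbar.shiftTo (X 0)).2.2.2.2
  exact hV.prodMk_nhds (hIt.prodMk_nhds (hv.prodMk_nhds (hI.prodMk_nhds hΩ)))

/-- Solutions of the primary-controlled system that stay in a region of regular loads converge. -/
theorem AdmissibleGains.tendsto_primaryLoop (hK : G.AdmissibleGains K)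
    (hk₄ : ∀ i, K.k₄ i = K.k₁ i - 1) {Xbar : PrimaryState N M} (hXbar : G.primaryLoop K Xbar = 0)
    {c c' ρ : ℝ} (hρ : 0 ≤ ρ) (hreg : G.IsRegularLoad Xbar.1 c' ρ)
    (hW : ODEStability.IsLyapunovFunctionOn (G.primaryLoop K)
      (fun X => G.energy K (X - Xbar).extend) Xbar c ρ) {X : ℝ → PrimaryState N M}
    (hX : IsIntegralCurveOn X (fun _ => G.primaryLoop K) (Ici 0))
    (hball : ∀ t, 0 ≤ t → dist (X t) Xbar ≤ ρ) : Tendsto X atTop (𝓝 Xbar) := by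
  have hfst : ∀ Y : PrimaryState N M, dist Y Xbar ≤ ρ → dist Y.1 Xbar.1 ≤ ρ := fun Y hY =>
    (le_max_left _ _).trans hY
  have hf : ContinuousOn (G.primaryLoop K) (closedBall Xbar ρ) := fun Y hY =>
    (contDiffAt_primaryLoop (hreg.contDiffAt _ (hfst Y hY))).continuousAt.continuousWithinAt
  have hreg' : G.IsRegularLoad Xbar.extend.1 c' ρ := hreg
  obtain ⟨l, hl⟩ := hW.exists_tendsto hX hball
  have hD : Tendsto (fun t => G.dissipation K Xbar.extend (X t).extend) atTop (𝓝 0) := by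
    have := ODEStability.tendsto_zero_along_integralCurve hf hX hball
      (g := fun Y => -G.dissipation K Xbar.extend Y.extend)
      ((continuousOn_dissipation (K := K) hreg').comp
        PrimaryState.extend.continuous.continuousOn hfst).neg
      (fun t ht => by
        have h := ODEStability.hasDerivWithinAt_comp_integralCurve hW.differentiable hX ht
        rwa [hK.fderiv_energy_primaryLoop hk₄ hXbar] at h) hl
    simpa using this.neg
  obtain ⟨hV, hI, hyz⟩ := hK.tendsto_of_dissipation hreg'
    ((eventually_ge_atTop 0).mono fun t ht => hfst _ (hball t ht)) hD
  have hVder : ∀ i, Tendsto (fun t => (G.primaryLoop K (X t)).1 i) atTop (𝓝 0) := fun i =>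
    ODEStability.tendsto_zero_along_integralCurve hf hX hball
      (g := fun Y => (G.primaryLoop K Y).1 i)
      ((continuous_apply i).comp_continuousOn (continuous_fst.comp_continuousOn hf))
      (fun t ht => hasDerivWithinAt_pi.1 (hX t ht).fst i) (tendsto_pi_nhds.1 hV i)
  obtain ⟨hIt, hv⟩ := hK.tendsto_current_integrator (Xbar := Xbar.extend)
    (hreg'.contDiffAt _ (by rwa [dist_self])).continuousAt (congrArg Prod.fst hXbar) hV hI hyz hVder
  exact hV.prodMk_nhds (hIt.prodMk_nhds (hv.prodMk_nhds hI))

end Microgrid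

/-! ### The stability theorem -/

theorem theorem2 {N M : ℕ} (G : Microgrid N M) (K : Gains N)
    (hK : G.AdmissibleGains K) (hk₄ : ∀ i, K.k₄ i = K.k₁ i - 1)
    (hP : ∀ i, 1 < G.r i → 0 ≤ G.PL i) :
    -- primary and secondary control
    (∀ Vbar : Fin N → ℝ, G.IsPositivePowerFlowSolution Vbar → G.LoadCondition Vbar →
      (∃ Xbar : State N M, Xbar.voltage = Vbar ∧ G.closedLoop K Xbar = 0) ∧
      ∀ Xbar : State N M, Xbar.voltage = Vbar → G.closedLoop K Xbar = 0 →
        (ODEStability.IsStableOn (G.closedLoop K) Set.univ Xbar ∧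
          ODEStability.IsLocallyAsymptoticallyStableOn (G.closedLoop K) Xbar.leaf Xbar ∧
          ∃ δ > 0, ∀ X : ℝ → State N M,
            IsIntegralCurveOn X (fun _ => G.closedLoop K) (Set.Ici 0) → dist (X 0) Xbar < δ →
            Filter.Tendsto X Filter.atTop (𝓝 (Xbar.shiftTo (X 0)))) ∧
        ((∀ i, G.ePower Vbar i = 0) →
          ODEStability.IsGloballyAsymptoticallyStableOn (G.closedLoop K) Xbar.leaf Xbar ∧
          ∀ X : ℝ → State N M,
            IsIntegralCurveOn X (fun _ => G.closedLoop K) (Set.Ici 0) →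
            Filter.Tendsto X Filter.atTop (𝓝 (Xbar.shiftTo (X 0))))) ∧
    -- primary control only
    (G.LoadCondition G.Vref →
      (∃! Xbar' : PrimaryState N M, G.primaryLoop K Xbar' = 0) ∧
      ∀ Xbar' : PrimaryState N M, G.primaryLoop K Xbar' = 0 →
        ODEStability.IsLocallyAsymptoticallyStableOn (G.primaryLoop K) Set.univ Xbar') := by
  refine ⟨fun Vbar hVbar hload => ⟨hVbar.exists_equilibrium hK, ?_⟩, fun hload =>
    ⟨hK.existsUnique_equilibrium, ?_⟩⟩
  · rintro Xbar rfl hXbar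
    obtain ⟨c, hc, hlyap⟩ := hK.exists_isLyapunovFunctionOn_closedLoop hk₄ hXbar
    obtain ⟨c', ρ, hρ, hreg⟩ := hload.exists_isRegularLoad hVbar.pos hP
    have hW := hlyap c' ρ hreg
    have hstable := hW.isStableOn hρ fun X hX =>
      Microgrid.contDiffAt_closedLoop (hreg.contDiffAt _ (Microgrid.dist_fst_le_of_dist_le hX))
    have hlocal : ∃ δ > 0, ∀ X : ℝ → State N M,
        IsIntegralCurveOn X (fun _ => G.closedLoop K) (Set.Ici 0) → dist (X 0) Xbar < δ →
        Filter.Tendsto X Filter.atTop (𝓝 (Xbar.shiftTo (X 0))) := by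
      obtain ⟨δ, hδ, hδW⟩ := hW.exists_pos_forall_lt hρ
      exact ⟨δ, hδ, fun X hX h0 => hK.tendsto_shiftTo hk₄ hXbar hρ.le hreg hW hX fun t ht =>
        (hW.dist_lt hρ ordConnected_Ici self_mem_Ici hX (hδW _ h0) t ht ht).le⟩
    refine ⟨⟨hstable _, ⟨Microgrid.isForwardInvariant_leaf Xbar, hstable _, ?_⟩, hlocal⟩,
      fun hE => ?_⟩
    · obtain ⟨δ, hδ, h⟩ := hlocal
      refine ⟨δ, hδ, fun X hX h0 hd => ?_⟩
      have := h X hX hd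
      rwa [State.shiftTo_eq_self h0] at this
    -- Powers of positive voltages are positive, so zero E-load power at `Vbar` means no E load at
    -- any voltage.
    · have hPL : ∀ i, G.PL i = 0 := fun i =>
        (mul_eq_zero.1 (hE i)).resolve_right (Real.rpow_pos_of_pos (hVbar.pos i) _).ne'
      obtain ⟨c'', hregAll⟩ := Microgrid.exists_isRegularLoad_of_PL_eq_zero hPL Xbar.1
      -- Every initial state lies in some sublevel set `{W < c * r ^ 2}`, as `c` does not depend on
      -- `r`.
      have hlarge : ∀ X₀ : State N M, ∃ r > 0, G.energy K (X₀ - Xbar) < c * r ^ 2 := fun X₀ => by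
        have h : Tendsto (fun r : ℝ => c * r ^ 2) atTop atTop :=
          (tendsto_pow_atTop two_ne_zero).const_mul_atTop hc
        obtain ⟨r, h1, h2⟩ := ((h.eventually_gt_atTop (G.energy K (X₀ - Xbar))).and
          (eventually_gt_atTop 0)).exists
        exact ⟨r, h2, h1⟩
      have hglobal : ∀ X : ℝ → State N M,
          IsIntegralCurveOn X (fun _ => G.closedLoop K) (Set.Ici 0) →
          Filter.Tendsto X Filter.atTop (𝓝 (Xbar.shiftTo (X 0))) := fun X hX => by
        obtain ⟨r, hr, h0⟩ := hlarge (X 0)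
        have hWr := hlyap c'' r (hregAll r)
        exact hK.tendsto_shiftTo hk₄ hXbar hr.le (hregAll r) hWr hX fun t ht =>
          (hWr.dist_lt hr ordConnected_Ici self_mem_Ici hX h0 t ht ht).le
      refine ⟨⟨Microgrid.isForwardInvariant_leaf Xbar, hstable _, fun X₀ _ => ?_,
        fun X hX h0 => ?_⟩, hglobal⟩
      · obtain ⟨r, hr, h0⟩ := hlarge X₀
        -- Radius `r + 1` leaves room for the cut-off outside the ball of radius `r`.
        exact (hlyap c'' (r + 1) (hregAll _)).exists_integralCurveOn_Ici (fun X hX =>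
          Microgrid.contDiffAt_closedLoop ((hregAll (r + 1)).contDiffAt _
            (Microgrid.dist_fst_le_of_dist_le hX))) hr (lt_add_one r) h0
      · have := hglobal X hX
        rwa [State.shiftTo_eq_self h0] at this
  · intro Xbar hXbar
    have hV : Xbar.1 = G.Vref := by
      ext i
      have h : G.Vref i - Xbar.1 i = 0 := congrFun (congrArg (fun Y => Y.2.2.1) hXbar) i
      linarith
    obtain ⟨c, hc, hlyap⟩ := hK.exists_isLyapunovFunctionOn_primaryLoop hk₄ hXbar
    obtain ⟨c', ρ, hρ, hreg⟩ := hload.exists_isRegularLoad G.Vref_pos hP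
    rw [← hV] at hreg
    have hW := hlyap c' ρ hreg
    refine ⟨fun _ _ _ _ _ _ _ => trivial, hW.isStableOn hρ (fun X hX =>
      Microgrid.contDiffAt_primaryLoop (hreg.contDiffAt _ ((le_max_left _ _).trans hX))) _, ?_⟩
    obtain ⟨δ, hδ, hδW⟩ := hW.exists_pos_forall_lt hρ
    exact ⟨δ, hδ, fun X hX _ h0 => hK.tendsto_primaryLoop hk₄ hXbar hρ.le hreg hW hX fun t ht =>
      (hW.dist_lt hρ ordConnected_Ici self_mem_Ici hX (hδW _ h0) t ht ht).le⟩
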